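/- Let $A$ be a partially ordered set with a top element $\top$ and a bottom element $\bot$. **Games.** Games over $A$ are defined inductively: for every $a\in A$ there is an atomic game $[a]$, which has no options, and for all non-empty sets $L,R$ of games there is a composite game $\{L\mid R\}$, whose left options are the elements of $L$ and whose right options are the elements of $R$. The positions of a game $G$ are $G$ itself, its left and right options, their options, and so on; $G$ is finite if it has finitely many positions. The depth of a finite game is $0$ if it is atomic, and otherwise one more than the maximum depth of its options. The branching factor of a finite game $G$ is the maximum, over all positions $H$ of $G$, of the number of left options and of the number of right options of $H$. **Order.** The relations $\leq$ and $\vartriangleleft$ on games are defined by mutual recursion. $G\leq H$ holds iff $G^L\vartriangleleft H$ for all left options $G^L$ of $G$, and $G\vartriangleleft H^R$ for all right options $H^R$ of $H$, and, in case $G$ or $H$ is atomic, $G\vartriangleleft H$. $G\vartriangleleft H$ holds iff $G^R\leq H$ for some right option $G^R$ of $G$, or $G\leq H^L$ for some left option $H^L$ of $H$, or $G=[a]$ and $H=[b]$ are atomic with $a\leq b$. Games $G,H$ are equivalent if $G\leq H$ and $H\leq G$. A left option $G^L$ of $G$ is good if $G\leq G^L$, and a right option $G^R$ of $G$ is good if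 $G^R\leq G$. A game is monotone if in each of its positions all left and right options are good, and passable if each of its positions is atomic or has at least one good left or right option. **Monotone set coloring games.** A monotone set coloring game $S$ over $A$ consists of a finite set $|S|$ of cells and a payoff function $\pi_S:\{\bot,\top\}^{|S|}\to A$ that is monotone for the pointwise order with $\bot<\top$. To each map $p:|S|\to\{\top,\bot,\star\}$, where $\star$ marks an empty cell, one associates a game $[\![p]\!]$ over $A$: it is $[\pi_S(p)]$ if $p$ has no empty cell, and otherwise it is the composite game whose left (right) options are the games $[\![p']\!]$, where $p'$ is obtained from $p$ by giving exactly one empty cell the color $\top$ (respectively $\bot$). The game $[\![S]\!]$ is $[\![p]\!]$ for the $p$ in which all cells are empty. A game $G$ over $A$ is realizable with size $n$ if $G$ is equivalent to $[\![S]\!]$ for some monotone set coloring game $S$ over $A$ with exactly $n$ cells. **Proposition 4.5.** Let $G$ be a finite game over $A$, and let $d$ and $b$ be its depth and branching factor, respectively. (a) If $G$ is monotone, then $G$ is realizable with size $(2^d-1)(4\lceil\log_2 b\rceil+7)$. (b) If $G$ is passable, then $G$ is realizable with size $(2^d-1)(4\lceil\log_2 b\rceil+10)$. (If $d=0$, then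 $b=0$ and both sizes are read as $0$.) -/

import Mathlib

universe u

namespace PosetGame

/-! ### Games over a set of atoms -/

/-- One layer of a game over `A`: either an atom, or a pair of non-empty sets (of left options
and of right options).  `Small` says that they are sets, as opposed to proper classes. -/
def Layer (A : Type u) (X : Type (u + 1)) : Type (u + 1) :=
  A ⊕ {LR : Set X × Set X // LR.1.Nonempty ∧ LR.2.Nonempty ∧ Small.{u} LR.1 ∧ Small.{u} LR.2}

/-- Presentation of `Layer A` by families of options, indexed by non-empty types. -/
def layerShape (A : Type u) : PFunctor.{u + 1, u + 1} where
  A := A ⊕ {p : Type u × Type u // Nonempty p.1 ∧ Nonempty p.2}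
  B s := match s with
    | .inl _ => PEmpty
    | .inr p => ULift.{u + 1} (p.1.1 ⊕ p.1.2)

/-- The functorial action of `Layer A`: take the image of both sets of options. -/
def Layer.map {A : Type u} {X Y : Type (u + 1)} (f : X → Y) : Layer A X → Layer A Y
  | .inl a => .inl a
  | .inr x => .inr ⟨(f '' x.1.1, f '' x.1.2), x.2.1.image f, x.2.2.1.image f,
      @small_image _ _ f _ x.2.2.2.1, @small_image _ _ f _ x.2.2.2.2⟩

instance (A : Type u) : Functor (Layer A) where
  map := Layer.map

/-- From families of options to sets of options. -/
def Layer.abs {A : Type u} {X : Type (u + 1)} : layerShape A X → Layer A X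
  | ⟨.inl a, _⟩ => .inl a
  | ⟨.inr p, f⟩ => .inr ⟨(Set.range fun i => f ⟨.inl i⟩, Set.range fun j => f ⟨.inr j⟩),
      @Set.range_nonempty _ _ p.2.1 _, @Set.range_nonempty _ _ p.2.2 _,
      small_range _, small_range _⟩

/-- Index the sets of options by themselves. -/
noncomputable def Layer.repr {A : Type u} {X : Type (u + 1)} : Layer A X → layerShape A X
  | .inl a => ⟨.inl a, fun i => nomatch i⟩
  | .inr x =>
      haveI : Small.{u} x.1.1 := x.2.2.2.1
      haveI : Small.{u} x.1.2 := x.2.2.2.2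
      ⟨.inr ⟨(Shrink.{u} x.1.1, Shrink.{u} x.1.2),
          x.2.1.to_subtype.map (equivShrink _), x.2.2.1.to_subtype.map (equivShrink _)⟩,
        fun i => Sum.elim (fun i => ((equivShrink x.1.1).symm i).1)
          (fun j => ((equivShrink x.1.2).symm j).1) (ULift.down i)⟩

noncomputable instance (A : Type u) : QPF (Layer A) where
  P := layerShape A
  abs := Layer.abs
  repr := Layer.repr
  abs_repr := by
    rintro X (a | x)
    · rfl
    · have : Small.{u} x.1.1 := x.2.2.2.1
      have : Small.{u} x.1.2 := x.2.2.2.2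
      have h (s : Set X) [Small.{u} s] :
          (Set.range fun i => ((equivShrink s).symm i).1) = s := by
        rw [show (fun i => ((equivShrink s).symm i).1) = Subtype.val ∘ (equivShrink s).symm
          from rfl, EquivLike.range_comp, Subtype.range_coe]
      exact congrArg Sum.inr (Subtype.ext (Prod.ext (h x.1.1) (h x.1.2)))
  abs_map := by
    rintro X Y f ⟨(a | p), g⟩
    · rfl
    · exact congrArg Sum.inr (Subtype.ext (Prod.ext
        (Set.range_comp f (fun i : p.1.1 => g ⟨.inl i⟩))
        (Set.range_comp f (fun j : p.1.2 => g ⟨.inr j⟩))))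

/-- Combinatorial games over `A`: the smallest class that contains an atomic game `[a]` for every
`a : A`, and a game `{L | R}` for all non-empty sets `L`, `R` of games (the initial algebra of
`Layer A`).  Options form honest sets, so repeated options are counted once. -/
def Game (A : Type u) : Type (u + 1) := QPF.Fix (Layer A)

namespace Game

variable {A : Type u}

/-- The atomic game `[a]`. -/
noncomputable def atom (a : A) : Game A := QPF.Fix.mk (F := Layer A) (Sum.inl a)

/-- The composite game `{L | R}`. -/
noncomputable def comp (L R : Set (Game A)) (hL : L.Nonempty) (hR : R.Nonempty)
    [sL : Small.{u} L] [sR : Small.{u} R] : Game A :=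
  QPF.Fix.mk (F := Layer A) (Sum.inr ⟨(L, R), hL, hR, sL, sR⟩)

/-- The set of left options; it is empty if the game is atomic. -/
noncomputable def leftOptions (G : Game A) : Set (Game A) :=
  match (QPF.Fix.dest G : Layer A (Game A)) with
  | .inl _ => ∅
  | .inr x => x.1.1

/-- The set of right options; it is empty if the game is atomic. -/
noncomputable def rightOptions (G : Game A) : Set (Game A) :=
  match (QPF.Fix.dest G : Layer A (Game A)) with
  | .inl _ => ∅
  | .inr x => x.1.2

@[simp] theorem leftOptions_atom (a : A) : (atom a).leftOptions = ∅ := by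
  unfold leftOptions atom
  erw [QPF.Fix.dest_mk]

@[simp] theorem rightOptions_atom (a : A) : (atom a).rightOptions = ∅ := by
  unfold rightOptions atom
  erw [QPF.Fix.dest_mk]

@[simp] theorem leftOptions_comp (L R : Set (Game A)) (hL : L.Nonempty) (hR : R.Nonempty)
    [Small.{u} L] [Small.{u} R] : (comp L R hL hR).leftOptions = L := by
  unfold leftOptions comp
  erw [QPF.Fix.dest_mk]

@[simp] theorem rightOptions_comp (L R : Set (Game A)) (hL : L.Nonempty) (hR : R.Nonempty)
    [Small.{u} L] [Small.{u} R] : (comp L R hL hR).rightOptions = R := by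
  unfold rightOptions comp
  erw [QPF.Fix.dest_mk]

theorem atom_injective : Function.Injective (atom : A → Game A) := by
  intro a b h
  have h' := congrArg (QPF.Fix.dest (F := Layer A)) h
  unfold atom at h'
  erw [QPF.Fix.dest_mk, QPF.Fix.dest_mk] at h'
  exact Sum.inl.inj h'

/-- The induction principle for games. -/
theorem induction {p : Game A → Prop} (h_atom : ∀ a, p (atom a))
    (h_comp : ∀ (L R : Set (Game A)) (hL : L.Nonempty) (hR : R.Nonempty)
      [Small.{u} L] [Small.{u} R],
      (∀ G ∈ L, p G) → (∀ G ∈ R, p G) → p (comp L R hL hR)) (G : Game A) : p G := by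
  refine QPF.Fix.ind (F := Layer A) p ?_ G
  rintro x ⟨y, rfl⟩
  rcases y with a | ⟨⟨L, R⟩, hL, hR, sL, sR⟩
  · exact h_atom a
  · have : Small.{u} (Subtype.val '' L : Set (Game A)) := @small_image _ _ _ L sL
    have : Small.{u} (Subtype.val '' R : Set (Game A)) := @small_image _ _ _ R sR
    refine h_comp (Subtype.val '' L) (Subtype.val '' R) (hL.image _) (hR.image _) ?_ ?_
    · rintro _ ⟨H, _, rfl⟩
      exact H.2
    · rintro _ ⟨H, _, rfl⟩
      exact H.2

/-- `H.IsOption G`: the game `H` is a left or a right option of `G`. -/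
def IsOption (H G : Game A) : Prop := H ∈ G.leftOptions ∨ H ∈ G.rightOptions

theorem wellFounded_isOption : WellFounded (IsOption : Game A → Game A → Prop) := by
  refine ⟨fun G => ?_⟩
  induction G using induction with
  | h_atom a =>
    refine ⟨_, fun H hH => ?_⟩
    simp [IsOption] at hH
  | h_comp L R hL hR ihL ihR =>
    refine ⟨_, fun H hH => ?_⟩
    simp only [IsOption, leftOptions_comp, rightOptions_comp] at hH
    exact hH.elim (ihL H) (ihR H)

instance : WellFoundedRelation (Game A) := ⟨IsOption, wellFounded_isOption⟩

/-- A game is atomic if it is of the form `[a]`. -/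
def IsAtomic (G : Game A) : Prop := ∃ a, G = atom a

/-- The positions of `G`: the game `G`, its options, their options, and so on. -/
def positions (G : Game A) : Set (Game A) := {H | Relation.ReflTransGen IsOption H G}

/-- A game is finite if it has finitely many positions. -/
def IsFinite (G : Game A) : Prop := G.positions.Finite

/-- The depth of a finite game: `0` for an atomic game, and one more than the maximum of the
depths of the options for a composite one. -/
noncomputable def depth (G : Game A) : ℕ :=
  ⨆ H : {H : Game A // IsOption H G}, (depth H.1 + 1)
termination_by G
decreasing_by exact H.2

/-- The branching factor of a finite game: the maximum number of left options or right options
of any position. -/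
noncomputable def branchingFactor (G : Game A) : ℕ :=
  sSup {n | ∃ H ∈ G.positions, n = H.leftOptions.ncard ∨ n = H.rightOptions.ncard}

/-! ### The order on games -/

section Order

variable [PartialOrder A]

/- The relations `G ≤ H` (`Le G H`) and `G ⊲ H` (`Tri G H`), by mutual recursion.  As the
option relation is well-founded, the recursive clauses determine both relations; they are
recorded as equivalences in `le_iff` and `tri_iff`. -/
mutual

inductive Le : Game A → Game A → Prop
  | intro (G H : Game A)
      (left : ∀ K ∈ G.leftOptions, Tri K H)
      (right : ∀ K ∈ H.rightOptions, Tri G K)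
      (atomic : G.IsAtomic ∨ H.IsAtomic → Tri G H) : Le G H

inductive Tri : Game A → Game A → Prop
  | right (G H K : Game A) (mem : K ∈ G.rightOptions) (le : Le K H) : Tri G H
  | left (G H K : Game A) (mem : K ∈ H.leftOptions) (le : Le G K) : Tri G H
  | atom (a b : A) (le : a ≤ b) : Tri (atom a) (atom b)

end

theorem le_iff {G H : Game A} :
    Le G H ↔ (∀ K ∈ G.leftOptions, Tri K H) ∧ (∀ K ∈ H.rightOptions, Tri G K) ∧
      (G.IsAtomic ∨ H.IsAtomic → Tri G H) :=
  ⟨fun | .intro _ _ h₁ h₂ h₃ => ⟨h₁, h₂, h₃⟩, fun ⟨h₁, h₂, h₃⟩ => .intro G H h₁ h₂ h₃⟩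

theorem tri_iff {G H : Game A} :
    Tri G H ↔ (∃ K ∈ G.rightOptions, Le K H) ∨ (∃ K ∈ H.leftOptions, Le G K) ∨
      (∃ a b, G = atom a ∧ H = atom b ∧ a ≤ b) := by
  constructor
  · rintro (⟨_, _, K, hK, h⟩ | ⟨_, _, K, hK, h⟩ | ⟨a, b, h⟩)
    · exact .inl ⟨K, hK, h⟩
    · exact .inr (.inl ⟨K, hK, h⟩)
    · exact .inr (.inr ⟨a, b, rfl, rfl, h⟩)
  · rintro (⟨K, hK, h⟩ | ⟨K, hK, h⟩ | ⟨a, b, rfl, rfl, h⟩)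
    · exact .right G H K hK h
    · exact .left G H K hK h
    · exact .atom a b h

/-- Equivalence of games. -/
def Equivalent (G H : Game A) : Prop := Le G H ∧ Le H G

/-- All left and right options are good (vacuous for atomic games). -/
def LocallyMonotone (G : Game A) : Prop :=
  (∀ K ∈ G.leftOptions, Le G K) ∧ (∀ K ∈ G.rightOptions, Le K G)

/-- The game is atomic, or it has a good left option or a good right option. -/
def LocallyPassable (G : Game A) : Prop :=
  G.IsAtomic ∨ (∃ K ∈ G.leftOptions, Le G K) ∨ (∃ K ∈ G.rightOptions, Le K G)

/-- All positions are locally monotone. -/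
def IsMonotone (G : Game A) : Prop := ∀ H ∈ G.positions, H.LocallyMonotone

/-- All positions are locally passable. -/
def IsPassable (G : Game A) : Prop := ∀ H ∈ G.positions, H.LocallyPassable

end Order

end Game

/-! ### Monotone set coloring games -/

/-- A monotone set coloring game over `A`: a finite set of cells and a monotone payoff function.
The Boolean `true` is the color of the left player, `false` that of the right player. -/
structure SetColoringGame (A : Type u) [PartialOrder A] where
  /-- The set of cells. -/
  carrier : Type
  /-- There are finitely many cells. -/
  finite_carrier : Finite carrier
  /-- The payoff function, monotone for the pointwise order with `false < true`. -/
  payoff : (carrier → Bool) →o A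

namespace SetColoringGame

variable {A : Type u} [PartialOrder A] (S : SetColoringGame A)

/-- The size: the number of cells. -/
noncomputable def size : ℕ := Nat.card S.carrier

/-- A position colors some of the cells; `none` marks an empty cell. -/
abbrev Position : Type := S.carrier → Option Bool

/-- The empty cells of a position. -/
abbrev EmptyCell (p : S.Position) : Type := {c : S.carrier // p c = none}

/-- The position obtained from `p` by coloring the cell `c` with the color `x`. -/
noncomputable def color (p : S.Position) (c : S.carrier) (x : Bool) : S.Position :=
  open Classical in Function.update p c (some x)

theorem card_emptyCell_color_lt (p : S.Position) (c : S.EmptyCell p) (x : Bool) :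
    Nat.card (S.EmptyCell (S.color p c.1 x)) < Nat.card (S.EmptyCell p) := by
  classical
  have := S.finite_carrier
  refine Set.ncard_lt_ncard (s := {d | S.color p c.1 x d = none}) (t := {d | p d = none}) ?_
    (Set.toFinite _)
  refine ⟨fun d hd => ?_, fun h => ?_⟩
  · by_cases hdc : d = c.1
    · subst hdc
      exact c.2
    · have h' : S.color p c.1 x d = p d := by
        unfold color
        exact Function.update_of_ne hdc _ _
      exact h'.symm.trans hd
  · have h' : S.color p c.1 x c.1 = some x := by
      unfold color
      exact Function.update_self _ _ _
    exact Option.some_ne_none x (h'.symm.trans (h c.2))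

/-- The game associated to a position `p`: the atomic game given by the payoff if there is no
empty cell; otherwise the left (right) options are the games associated to the positions in which
one empty cell of `p` has been colored by the left (right) player. -/
noncomputable def positionValue (p : S.Position) : Game A :=
  open Classical in
  if h : Nonempty (S.EmptyCell p) then
    haveI := h
    haveI := S.finite_carrier
    Game.comp
      (Set.range fun c : S.EmptyCell p => positionValue (S.color p c.1 true))
      (Set.range fun c : S.EmptyCell p => positionValue (S.color p c.1 false))
      (Set.range_nonempty _) (Set.range_nonempty _)
  else
    Game.atom (S.payoff fun c => (p c).get
      (Option.isSome_iff_ne_none.2 fun hc => h ⟨⟨c, hc⟩⟩))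
termination_by Nat.card (S.EmptyCell p)
decreasing_by all_goals exact S.card_emptyCell_color_lt p c _

/-- The game associated to `S`: that of the position in which all cells are empty. -/
noncomputable def value : Game A := S.positionValue fun _ => none

end SetColoringGame

/-- `G` is realizable with size `n`: it is equivalent to the game associated to some monotone set
coloring game with exactly `n` cells. -/
def Game.RealizableWithSize {A : Type u} [PartialOrder A] (G : Game A) (n : ℕ) : Prop :=
  ∃ S : SetColoringGame A, S.size = n ∧ G.Equivalent S.value

end PosetGame

/-!
The proof is by induction on the depth. Let `G` be composite, with options that are realized on `n`
cells. To realize `G` we take two copies of these `n` cells and a *switch*, a small number of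
further cells. The coloring of the switch either declares one of the players the winner or names an
option of one of the players, and one of the two copies, on which that option is then played. The
switch is such that each player can, by moving in it, secure any option in any copy, while a move of
the opponent in it can be answered so that nothing is lost: a good option is secured, or the
opponent is committed to an option, or the switch is as open as before. Since a move outside of the
switch spoils only one of the two copies, it is answered by securing an option in the other one.

A switch for `2 ^ k` options in each copy is built from one in which each player only chooses the
copy, by adding four cells for each bit. The initial switch has seven cells if both players have
good options. If only one player has a good option, then it has eight cells, and each copy gets one
additional cell, by which the opponent, who cannot afford to pass, threatens to win.
-/

namespace PosetGame

open Game

/-! ### The order, seen from the side of one of the players -/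

/-- The order of `A`, read upwards for the left player and downwards for the right player. -/
def sideLe {A : Type*} [LE A] (s : Bool) (a b : A) : Prop := if s then a ≤ b else b ≤ a

theorem sideLe_refl {A : Type*} [Preorder A] (s : Bool) (a : A) : sideLe s a a := by
  cases s <;> simp [sideLe]

theorem sideLe_trans {A : Type*} [Preorder A] {s : Bool} {a b c : A} (h : sideLe s a b)
    (h' : sideLe s b c) : sideLe s a c := by
  cases s
  · exact le_trans (α := A) h' h
  · exact le_trans (α := A) h h'

namespace Game

variable {A : Type*}

/-- The options of the player `s`. -/
noncomputable def opts (s : Bool) (G : Game A) : Set (Game A) :=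
  if s then G.leftOptions else G.rightOptions

@[simp] theorem opts_atom (s : Bool) (a : A) : opts s (atom a) = ∅ := by
  cases s <;> simp [opts]

theorem isOption_of_mem_opts {s : Bool} {G H : Game A} (h : H ∈ opts s G) : IsOption H G := by
  cases s
  · exact .inr h
  · exact .inl h

theorem option_induction {p : Game A → Prop}
    (h : ∀ G, (∀ s, ∀ K ∈ opts s G, p K) → p G) (G : Game A) : p G :=
  wellFounded_isOption.induction G fun G ih => h G fun _ _ hK => ih _ (isOption_of_mem_opts hK)

theorem isAtomic_or_opts_nonempty (G : Game A) : G.IsAtomic ∨ ∀ s, (opts s G).Nonempty := by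
  induction G using induction with
  | h_atom a => exact .inl ⟨a, rfl⟩
  | h_comp L R hL hR _ _ =>
    refine .inr fun s => ?_
    cases s
    · simpa [opts] using hR
    · simpa [opts] using hL

variable [PartialOrder A]

/-- The relation `≤` from the side of the player `s`. -/
def SLe (s : Bool) (G H : Game A) : Prop := if s then Le G H else Le H G

/-- The relation `⊲` from the side of the player `s`. -/
def STri (s : Bool) (G H : Game A) : Prop := if s then Tri G H else Tri H G

theorem sLe_iff {s : Bool} {G H : Game A} :
    SLe s G H ↔ (∀ K ∈ opts s G, STri s K H) ∧ (∀ K ∈ opts (!s) H, STri s G K) ∧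
      (G.IsAtomic ∨ H.IsAtomic → STri s G H) := by
  cases s
  · simp only [SLe, STri, opts, Bool.not_false, if_true, Bool.false_eq_true, if_false]
    rw [le_iff, or_comm]
    tauto
  · simp only [SLe, STri, opts, Bool.not_true, if_true, Bool.false_eq_true, if_false]
    exact le_iff

theorem sTri_iff {s : Bool} {G H : Game A} :
    STri s G H ↔ (∃ K ∈ opts (!s) G, SLe s K H) ∨ (∃ K ∈ opts s H, SLe s G K) ∨
      (∃ a b, G = atom a ∧ H = atom b ∧ sideLe s a b) := by
  cases s
  · simp only [SLe, STri, opts, sideLe, Bool.not_false, if_true, Bool.false_eq_true, if_false]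
    rw [tri_iff]
    constructor
    · rintro (h | h | ⟨a, b, h₁, h₂, h₃⟩)
      · exact .inr (.inl h)
      · exact .inl h
      · exact .inr (.inr ⟨b, a, h₂, h₁, h₃⟩)
    · rintro (h | h | ⟨a, b, h₁, h₂, h₃⟩)
      · exact .inr (.inl h)
      · exact .inl h
      · exact .inr (.inr ⟨b, a, h₂, h₁, h₃⟩)
  · simp only [SLe, STri, opts, sideLe, Bool.not_true, if_true, Bool.false_eq_true, if_false]
    exact tri_iff

theorem SLe.sTri_of_mem_left {s : Bool} {G H K : Game A} (h : SLe s G H) (hK : K ∈ opts s G) :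
    STri s K H := (sLe_iff.1 h).1 K hK

theorem SLe.sTri_of_mem_right {s : Bool} {G H K : Game A} (h : SLe s G H)
    (hK : K ∈ opts (!s) H) : STri s G K := (sLe_iff.1 h).2.1 K hK

theorem sTri_of_reply_left {s : Bool} {G H K : Game A} (hK : K ∈ opts (!s) G)
    (h : SLe s K H) : STri s G H := sTri_iff.2 (.inl ⟨K, hK, h⟩)

theorem sTri_of_reply_right {s : Bool} {G H K : Game A} (hK : K ∈ opts s H)
    (h : SLe s G K) : STri s G H := sTri_iff.2 (.inr (.inl ⟨K, hK, h⟩))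

theorem sTri_atom {s : Bool} {a b : A} (h : sideLe s a b) : STri s (atom a) (atom b) :=
  sTri_iff.2 (.inr (.inr ⟨a, b, rfl, rfl, h⟩))

theorem sLe_not {s : Bool} {G H : Game A} : SLe (!s) G H ↔ SLe s H G := by
  cases s <;> rfl

theorem sTri_not {s : Bool} {G H : Game A} : STri (!s) G H ↔ STri s H G := by
  cases s <;> rfl

theorem sLe_atom {s : Bool} {a b : A} (h : sideLe s a b) : SLe s (atom a) (atom b) :=
  sLe_iff.2 ⟨by simp, by simp, fun _ => sTri_atom h⟩

theorem sideLe_of_sLe_atom {s : Bool} {a b : A} (h : SLe s (atom a) (atom b)) : sideLe s a b := by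
  obtain ⟨K, hK, -⟩ | ⟨K, hK, -⟩ | ⟨_, _, ha, hb, h⟩ :=
    sTri_iff.1 ((sLe_iff.1 h).2.2 (.inl ⟨a, rfl⟩))
  · simp at hK
  · simp at hK
  · rwa [atom_injective ha, atom_injective hb]

theorem STri.trans_sLe_of_opts {s : Bool} {G H K : Game A}
    (ihG : ∀ X ∈ opts (!s) G, SLe s X H → SLe s H K → SLe s X K)
    (ihH : ∀ X ∈ opts s H, SLe s G X → STri s X K → STri s G K)
    (ihK : ∀ X ∈ opts s K, SLe s G H → SLe s H X → SLe s G X)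
    (h : STri s G H) (h' : SLe s H K) : STri s G K := by
  obtain ⟨X, hX, hXH⟩ | ⟨X, hX, hGX⟩ | ⟨a, b, rfl, rfl, hab⟩ := sTri_iff.1 h
  · exact sTri_of_reply_left hX (ihG X hX hXH h')
  · exact ihH X hX hGX (h'.sTri_of_mem_left hX)
  · obtain ⟨X, hX, -⟩ | ⟨X, hX, hX'⟩ | ⟨b', c, hb, rfl, hbc⟩ :=
      sTri_iff.1 ((sLe_iff.1 h').2.2 (.inl ⟨b, rfl⟩))
    · simp at hX
    · exact sTri_of_reply_right hX (ihK X hX (sLe_atom hab) hX')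
    · obtain rfl := atom_injective hb
      exact sTri_atom (sideLe_trans hab hbc)

theorem sLe_sTri_trans_laws (s : Bool) (G H K : Game A) :
    (SLe s G H → SLe s H K → SLe s G K) ∧ (STri s G H → SLe s H K → STri s G K) ∧
      (SLe s G H → STri s H K → STri s G K) := by
  induction G using option_induction generalizing H K with | _ G ihG
  induction H using option_induction generalizing K with | _ H ihH
  induction K using option_induction with | _ K ihK
  have sTri_sLe : STri s G H → SLe s H K → STri s G K :=
    STri.trans_sLe_of_opts (fun X hX => (ihG _ X hX H K).1) (fun X hX => (ihH _ X hX K).2.2)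
      fun X hX => (ihK _ X hX).1
  -- Read from the side of the opponent, this is the same law with `G` and `K` exchanged.
  have sLe_sTri (h : SLe s G H) (h' : STri s H K) : STri s G K := by
    rw [← sLe_not] at h
    rw [← sTri_not] at h' ⊢
    refine h'.trans_sLe_of_opts (fun X hX h₁ h₂ => ?_) (fun X hX h₁ h₂ => ?_)
      (fun X hX h₁ h₂ => ?_) h
    · rw [Bool.not_not] at hX
      rw [sLe_not] at h₁ h₂ ⊢
      exact (ihK _ X hX).1 h₂ h₁
    · rw [sLe_not] at h₁
      rw [sTri_not] at h₂ ⊢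
      exact (ihH _ X hX K).2.1 h₂ h₁
    · rw [sLe_not] at h₁ h₂ ⊢
      exact (ihG _ X hX H K).1 h₂ h₁
  refine ⟨fun h h' => sLe_iff.2 ⟨fun X hX => ?_, fun X hX => ?_, ?_⟩, sTri_sLe, sLe_sTri⟩
  · exact (ihG _ X hX H K).2.1 (h.sTri_of_mem_left hX) h'
  · exact (ihK _ X hX).2.2 h (h'.sTri_of_mem_right hX)
  · rintro (hG | hK)
    · exact sTri_sLe ((sLe_iff.1 h).2.2 (.inl hG)) h'
    · exact sLe_sTri h ((sLe_iff.1 h').2.2 (.inr hK))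

theorem SLe.trans {s : Bool} {G H K : Game A} (h : SLe s G H) (h' : SLe s H K) : SLe s G K :=
  (sLe_sTri_trans_laws s G H K).1 h h'

theorem STri.trans_sLe {s : Bool} {G H K : Game A} (h : STri s G H) (h' : SLe s H K) :
    STri s G K :=
  (sLe_sTri_trans_laws s G H K).2.1 h h'

theorem SLe.trans_sTri {s : Bool} {G H K : Game A} (h : SLe s G H) (h' : STri s H K) :
    STri s G K :=
  (sLe_sTri_trans_laws s G H K).2.2 h h'

theorem SLe.refl (s : Bool) (G : Game A) : SLe s G G := by
  induction G using option_induction with | _ G ih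
  refine sLe_iff.2 ⟨fun X hX => sTri_of_reply_right hX (ih _ X hX),
    fun X hX => sTri_of_reply_left hX (ih _ X hX), fun h => ?_⟩
  obtain ⟨a, rfl⟩ : G.IsAtomic := by tauto
  exact sTri_atom (sideLe_refl s a)

theorem equivalent_iff_sLe {G H : Game A} : G.Equivalent H ↔ ∀ s, SLe s G H := by
  constructor
  · rintro ⟨h, h'⟩ (_ | _)
    · exact h'
    · exact h
  · exact fun h => ⟨h true, h false⟩

theorem Equivalent.sLe {G H : Game A} (h : G.Equivalent H) (s : Bool) : SLe s G H :=
  equivalent_iff_sLe.1 h s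

theorem Equivalent.trans {G H K : Game A} (h : G.Equivalent H) (h' : H.Equivalent K) :
    G.Equivalent K :=
  equivalent_iff_sLe.2 fun s => (h.sLe s).trans (h'.sLe s)

end Game

/-! ### Comparing positions of set coloring games -/

section Coloring

variable {E F : Type}

open Classical in
/-- The position obtained by giving the cell `c` the color `x`; this is
`SetColoringGame.color`, for positions that are not tied to a game. -/
noncomputable def put (q : E → Option Bool) (c : E) (x : Bool) : E → Option Bool :=
  Function.update q c (some x)

@[simp] theorem put_self (q : E → Option Bool) (c : E) (x : Bool) : put q c x c = some x := by
  simp [put]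

theorem put_of_ne (q : E → Option Bool) {c d : E} (x : Bool) (h : d ≠ c) : put q c x d = q d := by
  simp [put, h]

theorem put_eq_some {q : E → Option Bool} {c d : E} {x y : Bool} (hc : q c = none)
    (hd : q d = some y) : put q c x d = some y := by
  rw [put_of_ne, hd]
  rintro rfl
  simp [hc] at hd

/-- The number of empty cells. -/
noncomputable def emptyCount (q : E → Option Bool) : ℕ := Nat.card {c // q c = none}

theorem emptyCount_put_lt [Finite E] {q : E → Option Bool} {c : E} (hc : q c = none) (x : Bool) :
    emptyCount (put q c x) < emptyCount q := by
  refine Set.ncard_lt_ncard (s := {d | put q c x d = none}) (t := {d | q d = none})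
    ⟨fun d hd => ?_, fun h => ?_⟩
  · obtain rfl | hdc := eq_or_ne d c
    · exact hc
    · exact (put_of_ne q x hdc).symm.trans hd
  · simpa using h hc

theorem exists_eq_some {p : E → Option Bool} (h : ¬∃ c, p c = none) :
    ∃ w : E → Bool, p = fun c => some (w c) := by
  choose w hw using fun c => Option.ne_none_iff_exists'.1 fun hc => h ⟨c, hc⟩
  exact ⟨w, funext hw⟩

/-- The states of a cell, compared from the side of the player `s`: the color of `s` is the best,
that of the opponent the worst. -/
def CellLe (s : Bool) (x y : Option Bool) : Prop := x = y ∨ x = some !s ∨ y = some s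

theorem CellLe.refl (s : Bool) (x : Option Bool) : CellLe s x x := .inl rfl

theorem CellLe.top {s : Bool} {x : Option Bool} : CellLe s x (some s) := .inr (.inr rfl)

theorem CellLe.bot {s : Bool} {x : Option Bool} : CellLe s (some !s) x := .inr (.inl rfl)

theorem CellLe.sideLe {s x y : Bool} (h : CellLe s (some x) (some y)) : sideLe s x y := by
  revert h
  cases s <;> cases x <;> cases y <;> simp [CellLe, PosetGame.sideLe]

variable {s : Bool} {f : E → F} {p : E → Option Bool} {q : F → Option Bool}

theorem cellLe_put_left (hpq : ∀ c, CellLe s (p c) (q (f c))) {c : E} {x : Bool}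
    (hx : CellLe s (some x) (q (f c))) (c' : E) : CellLe s (put p c x c') (q (f c')) := by
  obtain rfl | h := eq_or_ne c' c
  · rwa [put_self]
  · rw [put_of_ne _ _ h]
    exact hpq c'

theorem cellLe_put_right (hpq : ∀ c, CellLe s (p c) (q (f c))) {d : F} {x : Bool}
    (hx : ∀ c, f c = d → CellLe s (p c) (some x)) (c : E) :
    CellLe s (p c) (put q d x (f c)) := by
  obtain h | h := eq_or_ne (f c) d
  · rw [h, put_self]
    exact hx c h
  · rw [put_of_ne _ _ h]
    exact hpq c

theorem cellLe_put_both (hf : Function.Injective f) (hpq : ∀ c, CellLe s (p c) (q (f c)))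
    (c : E) (x : Bool) (c' : E) : CellLe s (put p c x c') (put q (f c) x (f c')) := by
  obtain rfl | h := eq_or_ne c' c
  · rw [put_self, put_self]
    exact .refl _ _
  · rw [put_of_ne _ _ h, put_of_ne _ _ (hf.ne h)]
    exact hpq c'

end Coloring

section Positions

variable {A : Type*} [PartialOrder A] (S T : SetColoringGame A) {s : Bool}

namespace SetColoringGame

theorem opts_positionValue (s : Bool) (p : S.Position) :
    opts s (S.positionValue p) = {K | ∃ c, p c = none ∧ K = S.positionValue (put p c s)} := by
  rw [positionValue]
  split_ifs with h
  · have := S.finite_carrier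
    ext K
    cases s <;> simp [opts, eq_comm, color, put]
  · ext K
    simp only [opts_atom, Set.mem_empty_iff_false, Set.mem_ofPred_eq, false_iff]
    rintro ⟨c, hc, -⟩
    exact h ⟨⟨c, hc⟩⟩

theorem positionValue_some (w : S.carrier → Bool) :
    S.positionValue (fun c => some (w c)) = atom (S.payoff w) := by
  rw [positionValue, dif_neg]
  · rfl
  · rintro ⟨c, hc⟩
    simp at hc

theorem mem_opts (s : Bool) {p : S.Position} {c : S.carrier} (hc : p c = none) :
    S.positionValue (put p c s) ∈ opts s (S.positionValue p) := by
  rw [opts_positionValue]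
  exact ⟨c, hc, rfl⟩

theorem ne_none_of_isAtomic {p : S.Position} (h : (S.positionValue p).IsAtomic) :
    ¬∃ c, p c = none := by
  rintro ⟨c, hc⟩
  obtain ⟨a, ha⟩ := h
  simpa [ha] using S.mem_opts true hc

theorem sideLe_payoff {v w : S.carrier → Bool} (h : ∀ c, sideLe s (v c) (w c)) :
    sideLe s (S.payoff v) (S.payoff w) := by
  cases s
  · exact S.payoff.monotone h
  · exact S.payoff.monotone h

theorem sTri_of_move {K : Game A} {p : S.Position} {c : S.carrier} (hc : p c = none)
    (h : SLe s K (S.positionValue (put p c s))) : STri s K (S.positionValue p) :=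
  sTri_of_reply_right (S.mem_opts s hc) h

theorem sTri_positionValue {p : S.Position} {q : T.Position}
    (hp : ∀ c, p c = none → SLe s (S.positionValue (put p c !s)) (T.positionValue q))
    (hq : ∀ d, q d = none → SLe s (S.positionValue p) (T.positionValue (put q d s)))
    (hpq : ∀ v w, p = (fun c => some (v c)) → q = (fun d => some (w d)) →
      sideLe s (S.payoff v) (T.payoff w)) :
    STri s (S.positionValue p) (T.positionValue q) := by
  by_cases hd : ∃ d, q d = none
  · obtain ⟨d, hd⟩ := hd
    exact T.sTri_of_move hd (hq d hd)
  by_cases hc : ∃ c, p c = none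
  · obtain ⟨c, hc⟩ := hc
    exact sTri_of_reply_left (S.mem_opts (!s) hc) (hp c hc)
  obtain ⟨v, rfl⟩ := exists_eq_some hc
  obtain ⟨w, rfl⟩ := exists_eq_some hd
  rw [positionValue_some, positionValue_some]
  exact sTri_atom (hpq v w rfl rfl)

variable {S T}

/-- A sufficient condition for the position `q` of `T` to be at least as good for the player `s` as
the position `p` of `S`, where the cells of `S` are identified with some of the cells of `T`: the
cells compare, and so do the payoffs of all colorings that can still arise from `q`. -/
structure Dominates (s : Bool) (f : S.carrier → T.carrier) (p : S.Position) (q : T.Position) :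
    Prop where
  cellLe : ∀ c, CellLe s (p c) (q (f c))
  payoff_sideLe : ∀ w : T.carrier → Bool, (∀ d x, q d = some x → w d = x) →
    sideLe s (S.payoff (w ∘ f)) (T.payoff w)

namespace Dominates

variable {f : S.carrier → T.carrier} {p : S.Position} {q : T.Position}

theorem put_left (h : Dominates s f p q) {c : S.carrier} {x : Bool}
    (hx : CellLe s (some x) (q (f c))) : Dominates s f (put p c x) q :=
  ⟨cellLe_put_left h.cellLe hx, h.payoff_sideLe⟩

theorem payoff_sideLe_put (h : Dominates s f p q) {d : T.carrier} (hd : q d = none) {x : Bool}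
    {w : T.carrier → Bool} (hw : ∀ d' y, put q d x d' = some y → w d' = y) :
    sideLe s (S.payoff (w ∘ f)) (T.payoff w) :=
  h.payoff_sideLe w fun d' y hy => hw d' y (put_eq_some hd hy)

theorem put_right (h : Dominates s f p q) {d : T.carrier} (hd : q d = none) {x : Bool}
    (hx : ∀ c, f c = d → CellLe s (p c) (some x)) : Dominates s f p (put q d x) :=
  ⟨cellLe_put_right h.cellLe hx, fun _ => h.payoff_sideLe_put hd⟩

theorem put_both (h : Dominates s f p q) (hf : Function.Injective f) {c : S.carrier}
    (hc : q (f c) = none) (x : Bool) : Dominates s f (put p c x) (put q (f c) x) :=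
  ⟨cellLe_put_both hf h.cellLe c x, fun _ => h.payoff_sideLe_put hc⟩

theorem sTri (h : Dominates s f p q)
    (ih : ∀ p' q', emptyCount p' + emptyCount q' < emptyCount p + emptyCount q →
      Dominates s f p' q' → SLe s (S.positionValue p') (T.positionValue q')) :
    STri s (S.positionValue p) (T.positionValue q) := by
  have := S.finite_carrier
  have := T.finite_carrier
  refine sTri_positionValue S T (fun c hc => ?_) (fun d hd => ?_) ?_
  · exact ih _ _ (by have := emptyCount_put_lt hc !s; omega) (h.put_left .bot)
  · exact ih _ _ (by have := emptyCount_put_lt hd s; omega) (h.put_right hd fun _ _ => .top)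
  · rintro v w rfl rfl
    exact sideLe_trans (S.sideLe_payoff fun c => (h.cellLe c).sideLe)
      (h.payoff_sideLe w fun _ _ => Option.some.inj)

/-- Copying the moves of the opponent between the two positions is a strategy; a cell of `q` that
is already better for `s`, or does not exist in `S`, only provides a spare move. -/
theorem sLe (hf : Function.Injective f) (h : Dominates s f p q) :
    SLe s (S.positionValue p) (T.positionValue q) := by
  have := S.finite_carrier
  have := T.finite_carrier
  induction hn : emptyCount p + emptyCount q using Nat.strong_induction_on generalizing p q with
  | _ n ih
  subst hn
  refine sLe_iff.2 ⟨fun K hK => ?_, fun K hK => ?_, fun _ => h.sTri fun p' q' hlt h' =>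
    ih _ hlt h' rfl⟩
  · rw [opts_positionValue] at hK
    obtain ⟨c, hc, rfl⟩ := hK
    have hlt := emptyCount_put_lt hc s
    obtain hqc | hqc | hqc := h.cellLe c
    · rw [hc, eq_comm] at hqc
      have := emptyCount_put_lt hqc s
      exact T.sTri_of_move hqc (ih _ (by omega) (h.put_both hf hqc s) rfl)
    · simp [hc] at hqc
    · exact (h.put_left (hqc ▸ .refl _ _)).sTri fun p' q' hlt' h' => ih _ (by omega) h' rfl
  · rw [opts_positionValue] at hK
    obtain ⟨d, hd, rfl⟩ := hK
    have hlt := emptyCount_put_lt hd !s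
    by_cases hex : ∃ c, f c = d ∧ p c = none
    · obtain ⟨c, rfl, hc⟩ := hex
      have := emptyCount_put_lt hc !s
      exact sTri_of_reply_left (S.mem_opts (!s) hc)
        (ih _ (by omega) (h.put_both hf hd !s) rfl)
    · refine (h.put_right hd fun c hcd => ?_).sTri fun p' q' hlt' h' => ih _ (by omega) h' rfl
      obtain hpc | hpc | hpc := h.cellLe c
      · exact (hex ⟨c, hcd, by rw [hpc, hcd, hd]⟩).elim
      · rw [hpc]
        exact .bot
      · simp [hcd, hd] at hpc

end Dominates

theorem positionValue_sLe (f : S.carrier → T.carrier) (hf : Function.Injective f)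
    (hpay : ∀ w : T.carrier → Bool, sideLe s (S.payoff (w ∘ f)) (T.payoff w))
    {p : S.Position} {q : T.Position} (hpq : ∀ c, CellLe s (p c) (q (f c))) :
    SLe s (S.positionValue p) (T.positionValue q) :=
  Dominates.sLe hf ⟨hpq, fun w _ => hpay w⟩

variable (S)

theorem sLe_put (s : Bool) (p : S.Position) (c : S.carrier) :
    SLe s (S.positionValue p) (S.positionValue (put p c s)) :=
  positionValue_sLe id Function.injective_id (fun _ => sideLe_refl _ _)
    (cellLe_put_right (fun _ => .refl _ _) fun _ _ => .top)

theorem sTri_of_sLe {K : Game A} {p : S.Position} (h : SLe s K (S.positionValue p)) :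
    STri s K (S.positionValue p) := by
  by_cases hp : ∃ c, p c = none
  · obtain ⟨c, hc⟩ := hp
    exact S.sTri_of_move hc (h.trans (S.sLe_put s p c))
  · obtain ⟨w, rfl⟩ := exists_eq_some hp
    rw [positionValue_some] at h ⊢
    exact (sLe_iff.1 h).2.2 (.inr ⟨_, rfl⟩)

theorem sLe_positionValue {K : Game A} {p : S.Position}
    (h_left : ∀ X ∈ opts s K, STri s X (S.positionValue p))
    (h_right : ∀ c, p c = none → STri s K (S.positionValue (put p c !s)))
    (h_end : K.IsAtomic ∨ (¬∃ c, p c = none) → STri s K (S.positionValue p)) :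
    SLe s K (S.positionValue p) := by
  refine sLe_iff.2 ⟨h_left, fun X hX => ?_, fun h => h_end (h.imp_right S.ne_none_of_isAtomic)⟩
  rw [opts_positionValue] at hX
  obtain ⟨c, hc, rfl⟩ := hX
  exact h_right c hc

end SetColoringGame

end Positions


/-! ### Switches -/

/-- The outcomes of a switch: a win for one of the players, or one of the symbols of one of the
players. -/
inductive Outcome (ι : Type) : Type
  | ext (b : Bool)
  | sym (t : Bool) (i : ι)
  deriving DecidableEq

namespace Outcome

variable {ι : Type} {s t : Bool} {i : ι} {x y : Outcome ι}

/-- Distinct symbols are incomparable, and lie between the two wins. -/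
instance : PartialOrder (Outcome ι) where
  le x y := x = y ∨ x = ext false ∨ y = ext true
  le_refl _ := .inl rfl
  le_trans := by
    rintro x y z (rfl | rfl | rfl) (rfl | h | rfl) <;> simp_all
  le_antisymm := by
    rintro x y (rfl | rfl | rfl) (h | h | h) <;> simp_all

theorem sideLe_iff : sideLe s x y ↔ x = y ∨ x = ext !s ∨ y = ext s := by
  cases s
  · exact or_congr eq_comm or_comm
  · rfl

theorem sideLe_ext : sideLe s x (ext s) := sideLe_iff.2 (.inr (.inr rfl))

theorem ext_not_sideLe : sideLe s (ext !s) x := sideLe_iff.2 (.inr (.inl rfl))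

theorem eq_of_ext_sideLe (h : sideLe s (ext s) x) : x = ext s := by
  obtain rfl | h | h := sideLe_iff.1 h
  · rfl
  · simp at h
  · exact h

theorem eq_or_eq_of_sym_sideLe (h : sideLe s (sym t i) x) : x = sym t i ∨ x = ext s := by
  obtain h | h | h := sideLe_iff.1 h
  · exact .inl h.symm
  · simp at h
  · exact .inr h

end Outcome

/-- The player `s` can move to a position that satisfies `P`. -/
def CanMoveTo {E : Type} (s : Bool) (P : (E → Option Bool) → Prop) (q : E → Option Bool) : Prop :=
  ∃ c, q c = none ∧ P (put q c s)

/-- The player `s`, whose turn it is, can pass or move to a position that satisfies `P`. -/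
def CanReach {E : Type} (s : Bool) (P : (E → Option Bool) → Prop) (q : E → Option Bool) : Prop :=
  P q ∨ CanMoveTo s P q

section

variable {E : Type} {s : Bool} {P R : (E → Option Bool) → Prop} {q : E → Option Bool}

theorem CanMoveTo.mono (h : CanMoveTo s P q) (hPR : ∀ q, P q → R q) : CanMoveTo s R q := by
  obtain ⟨c, hc, h⟩ := h
  exact ⟨c, hc, hPR _ h⟩

theorem CanReach.mono (h : CanReach s P q) (hPR : ∀ q, P q → R q) : CanReach s R q :=
  h.imp (hPR q) fun h => h.mono hPR

end

section Secures

variable {O : Type*} [PartialOrder O] {Φ : SetColoringGame O} {s : Bool} {t : O} {q : Φ.Position}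

/-- With the opponent to move, the player `s` secures a payoff that is at least `t`. -/
def Secures (Φ : SetColoringGame O) (s : Bool) (t : O) (q : Φ.Position) : Prop :=
  SLe s (atom t) (Φ.positionValue q)

theorem secures_some {w : Φ.carrier → Bool} (h : sideLe s t (Φ.payoff w)) :
    Secures Φ s t fun c => some (w c) := by
  rw [Secures, SetColoringGame.positionValue_some]
  exact sLe_atom h

theorem canReach_secures (h : STri s (atom t) (Φ.positionValue q)) :
    CanReach s (Secures Φ s t) q := by
  obtain ⟨K, hK, -⟩ | ⟨K, hK, h⟩ | ⟨a, b, ha, hb, h⟩ := sTri_iff.1 h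
  · simp at hK
  · rw [SetColoringGame.opts_positionValue] at hK
    obtain ⟨c, hc, rfl⟩ := hK
    exact .inr ⟨c, hc, h⟩
  · left
    rw [Secures, ha, hb]
    exact sLe_atom h

theorem Secures.move (h : Secures Φ s t q) {c : Φ.carrier} (hc : q c = none) :
    CanReach s (Secures Φ s t) (put q c !s) :=
  canReach_secures (SLe.sTri_of_mem_right h (Φ.mem_opts (!s) hc))

theorem Secures.put_own (h : Secures Φ s t q) (c : Φ.carrier) : Secures Φ s t (put q c s) :=
  SLe.trans h (Φ.sLe_put s q c)

theorem Secures.sideLe {w : Φ.carrier → Bool} (h : Secures Φ s t fun c => some (w c)) :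
    PosetGame.sideLe s t (Φ.payoff w) := by
  rw [Secures, SetColoringGame.positionValue_some] at h
  exact sideLe_of_sLe_atom h

theorem secures_of_moves
    (h_some : ∀ w : Φ.carrier → Bool, q = (fun c => some (w c)) → PosetGame.sideLe s t (Φ.payoff w))
    (h_move : ∀ c, q c = none → CanReach s (Secures Φ s t) (put q c !s)) : Secures Φ s t q := by
  by_cases hq : ∃ c, q c = none
  · have h_reply (c) (hc : q c = none) : STri s (atom t) (Φ.positionValue (put q c !s)) := by
      obtain h | ⟨d, hd, h⟩ := h_move c hc
      · exact Φ.sTri_of_sLe h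
      · exact Φ.sTri_of_move hd h
    obtain ⟨c, hc⟩ := hq
    exact Φ.sLe_positionValue (by simp) h_reply fun _ =>
      (h_reply c hc).trans_sLe (sLe_not.1 (Φ.sLe_put (!s) q c))
  · obtain ⟨w, rfl⟩ := exists_eq_some hq
    exact secures_some (h_some w rfl)

theorem secures_of_invariant {P : Φ.Position → Prop}
    (h_some : ∀ w : Φ.carrier → Bool, P (fun c => some (w c)) → PosetGame.sideLe s t (Φ.payoff w))
    (h_move : ∀ q c, P q → q c = none → CanReach s P (put q c !s)) (h : P q) :
    Secures Φ s t q := by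
  have := Φ.finite_carrier
  induction hn : emptyCount q using Nat.strong_induction_on generalizing q with
  | _ n ih
  subst hn
  refine secures_of_moves (fun w hw => h_some w (hw ▸ h)) fun c hc => ?_
  have hlt := emptyCount_put_lt hc !s
  exact (h_move q c h hc).imp (ih _ hlt · rfl) fun ⟨d, hd, h⟩ =>
    ⟨d, hd, ih _ ((emptyCount_put_lt hd s).trans hlt) h rfl⟩

end Secures

/-- How the player `s` plays in a switch `Φ`.

* In a position satisfying `winning`, with the opponent to move, `s` threatens to win, and the
  opponent can at best secure one of their own symbols.
* In a position satisfying `calm`, with the opponent to move, `s` can choose any of the symbols in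
  `avail`, and can also make a move to a winning position. If the opponent moves, `s` can secure
  a good symbol or again reach such a position, unless the opponent has chosen a symbol. -/
structure SwitchStrategy {ι : Type} (Φ : SetColoringGame (Outcome ι)) (s : Bool)
    (avail good : Set ι) where
  winning : Φ.Position → Prop
  calm : Φ.Position → Prop
  winning_threat : ∀ q, winning q → CanReach s (Secures Φ s (.ext s)) q
  winning_move : ∀ q c, winning q → q c = none →
    CanReach s (Secures Φ s (.ext s)) (put q c !s) ∨
    (∃ j, Secures Φ s (.sym (!s) j) (put q c !s)) ∨ CanMoveTo s winning (put q c !s)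
  calm_choose : ∀ q, calm q → ∀ i ∈ avail, CanReach s (Secures Φ s (.sym s i)) q
  calm_win : ∀ q, calm q → CanMoveTo s winning q
  calm_move : ∀ q c, calm q → q c = none →
    (∃ i ∈ good, CanReach s (Secures Φ s (.sym s i)) (put q c !s)) ∨
    (∃ j, Secures Φ s (.sym (!s) j) (put q c !s)) ∨ CanMoveTo s calm (put q c !s) ∨
    CanMoveTo s winning (put q c !s)
  calm_start : calm fun _ => none

/-! ### Realizing a game by a switch -/

section SumPositions

variable {E F : Type} (q : E → Option Bool) (z : F → Option Bool)

theorem put_sumElim_inl (c : E) (x : Bool) :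
    put (Sum.elim q z) (.inl c) x = Sum.elim (put q c x) z := by
  unfold put
  convert Sum.update_elim_inl

theorem put_sumElim_inr (c : F) (x : Bool) :
    put (Sum.elim q z) (.inr c) x = Sum.elim q (put z c x) := by
  unfold put
  convert Sum.update_elim_inr

theorem sumElim_some (v : E → Bool) (w : F → Bool) :
    Sum.elim (fun c => some (v c)) (fun c => some (w c)) = fun c => some (Sum.elim v w c) := by
  ext c
  cases c <;> rfl

end SumPositions

section Realize

variable {A : Type*} [PartialOrder A]

/-- The set coloring game with a given payoff function. -/
abbrev cellGame {Z : Type} [Finite Z] (p : (Z → Bool) →o A) : SetColoringGame A where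
  carrier := Z
  finite_carrier := inferInstance
  payoff := p

theorem sLe_positionValue_of_top {S : SetColoringGame A} {s : Bool} {p : S.Position}
    (hp : ∀ a (w : S.carrier → Bool), (∀ c x, p c = some x → w c = x) → sideLe s a (S.payoff w))
    (K : Game A) : SLe s K (S.positionValue p) := by
  suffices SLe s K (S.positionValue p) ∧ STri s K (S.positionValue p) from this.1
  have := S.finite_carrier
  induction hn : emptyCount p using Nat.strong_induction_on generalizing K p with
  | _ n ihn
  subst hn
  have ih_put {c : S.carrier} (hc : p c = none) (x : Bool) :=
    ihn _ (emptyCount_put_lt hc x) (p := put p c x)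
      fun a w hw => hp a w fun _ _ hd => hw _ _ (put_eq_some hc hd)
  induction K using option_induction with
  | _ K ihK
  have h_tri : STri s K (S.positionValue p) := by
    by_cases hp' : ∃ c, p c = none
    · obtain ⟨c, hc⟩ := hp'
      exact S.sTri_of_move hc (ih_put hc s K rfl).1
    obtain ⟨a, rfl⟩ | hK := isAtomic_or_opts_nonempty K
    · obtain ⟨w, rfl⟩ := exists_eq_some hp'
      rw [S.positionValue_some]
      exact sTri_atom (hp a w fun _ _ h => Option.some_injective _ h)
    · obtain ⟨X, hX⟩ := hK (!s)
      exact sTri_of_reply_left hX (ihK _ X hX).1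
  exact ⟨S.sLe_positionValue (fun X hX => (ihK _ X hX).2) (fun c hc => (ih_put hc (!s) K rfl).2)
    fun _ => h_tri, h_tri⟩

variable [BoundedOrder A] {ι Z : Type}

/-- The payoff function on the remaining cells that belongs to an outcome of the switch. -/
def outcomePayoff (pay : Bool → ι → (Z → Bool) →o A) : Outcome ι → (Z → Bool) →o A
  | .ext b => OrderHom.const _ (if b then ⊤ else ⊥)
  | .sym t i => pay t i

theorem sideLe_top (s : Bool) (a : A) : sideLe s a (if s then ⊤ else ⊥) := by
  cases s <;> simp [sideLe]

theorem outcomePayoff_sideLe (pay : Bool → ι → (Z → Bool) →o A) {s : Bool} {x y : Outcome ι}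
    (h : sideLe s x y) (z : Z → Bool) :
    sideLe s (outcomePayoff pay x z) (outcomePayoff pay y z) := by
  obtain rfl | rfl | rfl := Outcome.sideLe_iff.1 h
  · exact sideLe_refl _ _
  · cases s <;> simp [sideLe, outcomePayoff]
  · cases s <;> simp [sideLe, outcomePayoff]

/-- The set coloring game on the remaining cells that belongs to an outcome of the switch. -/
abbrev outcomeGame [Finite Z] (pay : Bool → ι → (Z → Bool) →o A) (x : Outcome ι) :
    SetColoringGame A :=
  cellGame (outcomePayoff pay x)

/-- The set coloring game in which a switch decides about the payoff function that is used on the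
remaining cells. -/
abbrev switchGame [Finite Z] (Φ : SetColoringGame (Outcome ι)) (pay : Bool → ι → (Z → Bool) →o A) :
    SetColoringGame A where
  carrier := Φ.carrier ⊕ Z
  finite_carrier := have := Φ.finite_carrier; inferInstance
  payoff :=
    { toFun := fun w => outcomePayoff pay (Φ.payoff (w ∘ Sum.inl)) (w ∘ Sum.inr)
      monotone' := fun _ _ h =>
        le_trans ((outcomePayoff pay _).monotone fun c => h (Sum.inr c))
          (outcomePayoff_sideLe (s := true) pay (Φ.payoff.monotone fun c => h (Sum.inl c)) _) }

variable [Finite Z] {Φ : SetColoringGame (Outcome ι)} {pay : Bool → ι → (Z → Bool) →o A}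
  {s : Bool} {t : Outcome ι} {q : Φ.Position} {z : Z → Option Bool} {G : Game A}

theorem sTri_switchGame_of_canMoveTo {P : Φ.Position → Prop} (h : CanMoveTo s P q)
    (h_sLe : ∀ c, q c = none → P (put q c s) →
      SLe s G ((switchGame Φ pay).positionValue (Sum.elim (put q c s) z))) :
    STri s G ((switchGame Φ pay).positionValue (Sum.elim q z)) := by
  obtain ⟨c, hc, hP⟩ := h
  refine (switchGame Φ pay).sTri_of_move (c := Sum.inl c) hc ?_
  rw [put_sumElim_inl]
  exact h_sLe c hc hP

theorem sTri_switchGame_of_canReach {P : Φ.Position → Prop} (h : CanReach s P q)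
    (h_pass : P q → SLe s G ((switchGame Φ pay).positionValue (Sum.elim q z)))
    (h_move : ∀ c, q c = none → P (put q c s) →
      SLe s G ((switchGame Φ pay).positionValue (Sum.elim (put q c s) z))) :
    STri s G ((switchGame Φ pay).positionValue (Sum.elim q z)) :=
  h.elim (fun h => (switchGame Φ pay).sTri_of_sLe (h_pass h)) fun h =>
    sTri_switchGame_of_canMoveTo h h_move

theorem Secures.sLe_switchGame (h : Secures Φ s t q) :
    SLe s ((outcomeGame pay t).positionValue z)
      ((switchGame Φ pay).positionValue (Sum.elim q z)) := by
  have := Φ.finite_carrier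
  induction hn : emptyCount q + emptyCount z using Nat.strong_induction_on generalizing q z with
  | _ n ih
  subst hn
  refine (switchGame Φ pay).sLe_positionValue (fun X hX => ?_) ?_ fun h_end => ?_
  · rw [SetColoringGame.opts_positionValue] at hX
    obtain ⟨c, hc, rfl⟩ := hX
    refine (switchGame Φ pay).sTri_of_move (c := Sum.inr c) hc ?_
    rw [put_sumElim_inr]
    exact ih _ (by have := emptyCount_put_lt hc s; omega) h rfl
  · rintro (c | c) hc
    · have hlt := emptyCount_put_lt (q := q) hc !s
      rw [put_sumElim_inl]
      exact sTri_switchGame_of_canReach (h.move hc) (fun h => ih _ (by omega) h rfl)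
        fun d hd h => ih _ (by have := emptyCount_put_lt hd s; omega) h rfl
    · have hlt := emptyCount_put_lt (q := z) hc !s
      refine sTri_of_reply_left ((outcomeGame pay t).mem_opts (!s) hc) ?_
      rw [put_sumElim_inr]
      exact ih _ (by omega) h rfl
  · have hz : ¬∃ c, z c = none :=
      h_end.elim (outcomeGame pay t).ne_none_of_isAtomic fun h ⟨c, hc⟩ => h ⟨.inr c, hc⟩
    by_cases hq : ∃ c, q c = none
    · obtain ⟨c, hc⟩ := hq
      refine (switchGame Φ pay).sTri_of_move (c := Sum.inl c) hc ?_
      rw [put_sumElim_inl]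
      exact ih _ (by have := emptyCount_put_lt hc s; omega) (h.put_own c) rfl
    · obtain ⟨v, rfl⟩ := exists_eq_some hq
      obtain ⟨w, rfl⟩ := exists_eq_some hz
      rw [sumElim_some, SetColoringGame.positionValue_some, SetColoringGame.positionValue_some]
      exact sTri_atom (outcomePayoff_sideLe pay h.sideLe w)

theorem sTri_switchGame_of_canReach_secures (h : CanReach s (Secures Φ s t) q) :
    STri s ((outcomeGame pay t).positionValue z)
      ((switchGame Φ pay).positionValue (Sum.elim q z)) :=
  sTri_switchGame_of_canReach h Secures.sLe_switchGame fun _ _ => Secures.sLe_switchGame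

theorem sTri_switchGame_of_canReach_ext (h : CanReach s (Secures Φ s (.ext s)) q) :
    STri s G ((switchGame Φ pay).positionValue (Sum.elim q z)) := by
  have h_top : SLe s G ((outcomeGame pay (.ext s)).positionValue z) :=
    sLe_positionValue_of_top (S := outcomeGame pay (.ext s)) (fun a _ _ => sideLe_top s a) G
  exact h_top.trans_sTri (sTri_switchGame_of_canReach_secures h)

/-- A position with nothing but empty cells. -/
abbrev emptyPosition (Z : Type) : Z → Option Bool := fun _ => none

namespace SwitchStrategy

variable {avail good : Set ι} (σ : SwitchStrategy Φ s avail good)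

theorem sLe_switchGame_of_winning
    (h_theirs : ∀ j, STri s G (cellGame (pay (!s) j)).value) (hq : σ.winning q) :
    SLe s G ((switchGame Φ pay).positionValue (Sum.elim q (emptyPosition Z))) := by
  have := Φ.finite_carrier
  induction hn : emptyCount q using Nat.strong_induction_on generalizing q with
  | _ n ih
  subst hn
  have h_threat {K : Game A} {z : Z → Option Bool} :
      STri s K ((switchGame Φ pay).positionValue (Sum.elim q z)) :=
    sTri_switchGame_of_canReach_ext (σ.winning_threat q hq)
  refine (switchGame Φ pay).sLe_positionValue (fun X _ => h_threat) ?_ fun _ => h_threat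
  rintro (c | c) hc
  · rw [put_sumElim_inl]
    obtain h | ⟨j, h⟩ | h := σ.winning_move q c hq hc
    · exact sTri_switchGame_of_canReach_ext h
    · exact (h_theirs j).trans_sLe h.sLe_switchGame
    · exact sTri_switchGame_of_canMoveTo h fun d hd hw =>
        ih _ ((emptyCount_put_lt hd s).trans (emptyCount_put_lt (q := q) hc !s)) hw rfl
  · rw [put_sumElim_inr]
    exact h_threat

theorem sLe_switchGame_of_calm (hG : ¬ G.IsAtomic)
    (h_mine : ∀ K ∈ opts s G, ∃ i ∈ avail, SLe s K (cellGame (pay s i)).value)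
    (h_theirs : ∀ j, STri s G (cellGame (pay (!s) j)).value)
    (h_good : ∀ i ∈ good, SLe s G (cellGame (pay s i)).value)
    (h_cell : ∀ c : Z, ∃ i ∈ avail,
      SLe s G ((cellGame (pay s i)).positionValue (put (emptyPosition Z) c !s)))
    (hq : σ.calm q) :
    SLe s G ((switchGame Φ pay).positionValue (Sum.elim q (emptyPosition Z))) := by
  have := Φ.finite_carrier
  induction hn : emptyCount q using Nat.strong_induction_on generalizing q with
  | _ n ih
  subst hn
  refine (switchGame Φ pay).sLe_positionValue (fun X hX => ?_) ?_ ?_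
  · obtain ⟨i, hi, h⟩ := h_mine X hX
    exact h.trans_sTri (sTri_switchGame_of_canReach_secures (σ.calm_choose q hq i hi))
  · rintro (c | c) hc
    · rw [put_sumElim_inl]
      obtain ⟨i, hi, h⟩ | ⟨j, h⟩ | h | h := σ.calm_move q c hq hc
      · exact (h_good i hi).trans_sTri (sTri_switchGame_of_canReach_secures h)
      · exact (h_theirs j).trans_sLe h.sLe_switchGame
      · exact sTri_switchGame_of_canMoveTo h fun d hd hw =>
          ih _ ((emptyCount_put_lt hd s).trans (emptyCount_put_lt (q := q) hc !s)) hw rfl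
      · exact sTri_switchGame_of_canMoveTo h fun _ _ => σ.sLe_switchGame_of_winning h_theirs
    · obtain ⟨i, hi, h⟩ := h_cell c
      rw [put_sumElim_inr]
      exact h.trans_sTri (sTri_switchGame_of_canReach_secures (σ.calm_choose q hq i hi))
  · rintro (h | h)
    · exact (hG h).elim
    · obtain ⟨c, hc, -⟩ := σ.calm_win q hq
      exact (h ⟨Sum.inl c, hc⟩).elim

theorem sLe_value_switchGame (σ : SwitchStrategy Φ s avail good) (hG : ¬ G.IsAtomic)
    (h_mine : ∀ K ∈ opts s G, ∃ i ∈ avail, SLe s K (cellGame (pay s i)).value)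
    (h_theirs : ∀ j, STri s G (cellGame (pay (!s) j)).value)
    (h_good : ∀ i ∈ good, SLe s G (cellGame (pay s i)).value)
    (h_cell : ∀ c : Z, ∃ i ∈ avail,
      SLe s G ((cellGame (pay s i)).positionValue (put (emptyPosition Z) c !s))) :
    SLe s G (switchGame Φ pay).value := by
  have := σ.sLe_switchGame_of_calm hG h_mine h_theirs h_good h_cell σ.calm_start
  rwa [show Sum.elim (fun _ => none) (emptyPosition Z) = emptyPosition (Φ.carrier ⊕ Z) by
    ext c; cases c <;> rfl] at this

end SwitchStrategy

end Realize

/-! ### Doubling the number of symbols -/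

section PairOutcome

variable {ι : Type}

/-- The outcome `x` of a switch, modified by two additional cells for each player, where `u t k` is
the color of the `k`-th additional cell of the player `t`. A player who colors both of their cells
wins. Otherwise, the cells contribute an additional bit to the symbols of their player, unless the
opponent has colored both of them. -/
def pairOutcome (x : Outcome ι) (u : Bool → Bool → Bool) : Outcome (ι × Bool) :=
  if u true false ∧ u true true then .ext true
  else if ¬ u false false ∧ ¬ u false true then .ext false
  else match x with
    | .ext b => .ext b
    | .sym t i => if u t false = u t true then .ext !t else .sym t (i, u t false)

variable {s : Bool} {u v : Bool → Bool → Bool}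

theorem pairOutcome_mono_left {x y : Outcome ι} (hxy : x ≤ y) :
    pairOutcome x u ≤ pairOutcome y u := by
  unfold pairOutcome
  split_ifs
  · exact le_rfl
  · exact le_rfl
  · obtain rfl | rfl | rfl := hxy
    · exact le_rfl
    · exact .inr (.inl rfl)
    · exact .inr (.inr rfl)

theorem pairOutcome_mono_right (x : Outcome ι) (huv : ∀ t k, u t k → v t k) :
    pairOutcome x u ≤ pairOutcome x v := by
  have h₁ := huv true false
  have h₂ := huv true true
  have h₃ := huv false false
  have h₄ := huv false true
  unfold pairOutcome
  by_cases hv : v true false ∧ v true true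
  · rw [if_pos hv]
    exact .inr (.inr rfl)
  by_cases hu : ¬ u false false ∧ ¬ u false true
  · rw [if_neg (by tauto), if_pos hu]
    exact .inr (.inl rfl)
  rw [if_neg (by tauto), if_neg hu, if_neg hv, if_neg (by tauto)]
  obtain b | ⟨_ | _, i⟩ := x
  · exact le_rfl
  · dsimp only
    by_cases h : v false false = v false true
    · rw [if_pos h]
      exact .inr (.inr rfl)
    · have huv : u false false = v false false ∧ u false true = v false true := by
        grind
      rw [huv.1, huv.2]
  · dsimp only
    by_cases h : u true false = u true true
    · rw [if_pos h]
      exact .inr (.inl rfl)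
    · have huv : u true false = v true false ∧ u true true = v true true := by
        grind
      rw [huv.1, huv.2]

theorem pairOutcome_of_own (h_own : ∀ k, u s k = s) (h_opp : ∃ k, u (!s) k = s) (x : Outcome ι) :
    pairOutcome x u = .ext s := by
  have h₁ := h_own true
  have h₂ := h_own false
  obtain ⟨k, hk⟩ := h_opp
  cases s <;> cases k <;> simp_all [pairOutcome]

theorem pairOutcome_ext (h_opp : ∃ k, u (!s) k = s) :
    pairOutcome (.ext s : Outcome ι) u = .ext s := by
  obtain ⟨k, hk⟩ := h_opp
  cases s <;> cases k <;> simp_all [pairOutcome]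

theorem pairOutcome_theirs_of_all (h : ∀ k, u (!s) k = s) (j : ι) :
    pairOutcome (.sym (!s) j) u = .ext s := by
  have h₁ := h true
  have h₂ := h false
  cases s <;> simp_all [pairOutcome]

theorem sideLe_pairOutcome_mine (h_opp : ∃ k, u (!s) k = s) {b : Bool} (h₁ : u s false = b)
    (h₂ : u s true = !b) (i : ι) :
    sideLe s (.sym s (i, b)) (pairOutcome (.sym s i) u) := by
  rw [Outcome.sideLe_iff]
  obtain ⟨k, hk⟩ := h_opp
  cases s <;> cases k <;> cases b <;> simp_all [pairOutcome]

theorem sideLe_pairOutcome_theirs {b : Bool} (h₁ : u (!s) false = b) (h₂ : u (!s) true = !b)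
    (j : ι) : sideLe s (.sym (!s) (j, b)) (pairOutcome (.sym (!s) j) u) := by
  rw [Outcome.sideLe_iff]
  by_cases h : u s false = s ∧ u s true = s
  · obtain ⟨h₃, h₄⟩ := h
    cases s <;> cases b <;> simp_all [pairOutcome]
  · cases s <;> cases b <;> simp_all [pairOutcome]

end PairOutcome

section PairView

variable {E : Type} {s : Bool}

/-- A predicate on positions with two additional cells for each player, in terms of the position
without them, of the additional cells of `s` and of the additional cells of the opponent. -/
def PairView (s : Bool)
    (P : (E → Option Bool) → (Bool → Option Bool) → (Bool → Option Bool) → Prop)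
    (q : E ⊕ Bool × Bool → Option Bool) : Prop :=
  P (fun c => q (.inl c)) (fun k => q (.inr (s, k))) (fun k => q (.inr (!s, k)))

/-- The version of `CanMoveTo` that belongs to `PairView`. -/
def PairCanMoveTo (s : Bool)
    (P : (E → Option Bool) → (Bool → Option Bool) → (Bool → Option Bool) → Prop)
    (q : E → Option Bool) (z w : Bool → Option Bool) : Prop :=
  (∃ c, q c = none ∧ P (put q c s) z w) ∨ (∃ k, z k = none ∧ P q (put z k s) w) ∨
    ∃ k, w k = none ∧ P q z (put w k s)

/-- The version of `CanReach` that belongs to `PairView`. -/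
def PairCanReach (s : Bool)
    (P : (E → Option Bool) → (Bool → Option Bool) → (Bool → Option Bool) → Prop)
    (q : E → Option Bool) (z w : Bool → Option Bool) : Prop :=
  P q z w ∨ PairCanMoveTo s P q z w

variable {P R : (E → Option Bool) → (Bool → Option Bool) → (Bool → Option Bool) → Prop}
  {q : E ⊕ Bool × Bool → Option Bool} {x : Bool}

theorem put_comp_of_injective {E F : Type} {f : E → F} (hf : Function.Injective f)
    (q : F → Option Bool) (c : E) (x : Bool) : put q (f c) x ∘ f = put (q ∘ f) c x := by
  classical
  unfold put
  convert Function.update_comp_eq_of_injective q hf c (some x)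

theorem pairView_put_inl {c : E} :
    PairView s P (put q (.inl c) x) ↔ P (put (fun c => q (.inl c)) c x)
      (fun k => q (.inr (s, k))) (fun k => q (.inr (!s, k))) := by
  have := put_comp_of_injective Sum.inl_injective q c x
  simp only [Function.comp_def] at this
  simp [PairView, this, put_of_ne]

theorem pairView_put_own {k : Bool} :
    PairView s P (put q (.inr (s, k)) x) ↔ P (fun c => q (.inl c))
      (put (fun k => q (.inr (s, k))) k x) (fun k => q (.inr (!s, k))) := by
  have := put_comp_of_injective (Sum.inr_injective.comp (Prod.mk_right_injective s)) q k x
  simp only [Function.comp_def] at this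
  simp [PairView, this, put_of_ne]

theorem pairView_put_opp {k : Bool} :
    PairView s P (put q (.inr (!s, k)) x) ↔ P (fun c => q (.inl c))
      (fun k => q (.inr (s, k))) (put (fun k => q (.inr (!s, k))) k x) := by
  have := put_comp_of_injective (Sum.inr_injective.comp (Prod.mk_right_injective !s)) q k x
  simp only [Function.comp_def] at this
  simp [PairView, this, put_of_ne]

theorem canMoveTo_pairView (h : PairView s (PairCanMoveTo s P) q) :
    CanMoveTo s (PairView s P) q := by
  obtain ⟨c, hc, h⟩ | ⟨k, hk, h⟩ | ⟨k, hk, h⟩ := h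
  · exact ⟨.inl c, hc, pairView_put_inl.2 h⟩
  · exact ⟨.inr (s, k), hk, pairView_put_own.2 h⟩
  · exact ⟨.inr (!s, k), hk, pairView_put_opp.2 h⟩

theorem canReach_pairView (h : PairView s (PairCanReach s P) q) : CanReach s (PairView s P) q :=
  h.imp_right canMoveTo_pairView

theorem pairView_move (h_core : ∀ q z w c, P q z w → q c = none → R (put q c !s) z w)
    (h_own : ∀ q z w k, P q z w → z k = none → R q (put z k !s) w)
    (h_opp : ∀ q z w k, P q z w → w k = none → R q z (put w k !s))
    {c : E ⊕ Bool × Bool} (hq : PairView s P q) (hc : q c = none) :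
    PairView s R (put q c !s) := by
  obtain c | ⟨t, k⟩ := c
  · exact pairView_put_inl.2 (h_core _ _ _ c hq hc)
  · obtain rfl | rfl := Bool.eq_or_eq_not t s
    · exact pairView_put_own.2 (h_own _ _ _ k hq hc)
    · exact pairView_put_opp.2 (h_opp _ _ _ k hq hc)

theorem CanReach.pair {Q : (E → Option Bool) → Prop} {q : E → Option Bool}
    {z w : Bool → Option Bool} (h : CanReach s Q q) (hP : ∀ q, Q q → P q z w) :
    PairCanReach s P q z w := by
  obtain h | ⟨c, hc, h⟩ := h
  · exact .inl (hP _ h)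
  · exact .inr (.inl ⟨c, hc, hP _ h⟩)

theorem CanMoveTo.pair {Q : (E → Option Bool) → Prop} {q : E → Option Bool}
    {z w : Bool → Option Bool} (h : CanMoveTo s Q q) (hP : ∀ q, Q q → P q z w) :
    PairCanMoveTo s P q z w := by
  obtain ⟨c, hc, h⟩ := h
  exact .inl ⟨c, hc, hP _ h⟩

end PairView

section Pairs

variable {s b k : Bool} {w : Bool → Option Bool}

/-- The opponent's additional cells are untouched, or both are colored, but not both with the
color of the opponent. -/
def SafePair (s : Bool) (w : Bool → Option Bool) : Prop :=
  (∀ k, w k = none) ∨ ((∀ k, w k ≠ none) ∧ ∃ k, w k = some s)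

/-- The additional cells of a player encode the bit `b`. -/
def PairCode (b : Bool) (z : Bool → Option Bool) : Prop := z false = some b ∧ z true = some !b

theorem forall_put_eq {x : Bool} (h : w k = some x) (l : Bool) : put w (!k) x l = some x := by
  obtain rfl | rfl := Bool.eq_or_eq_not l k
  · rw [put_of_ne _ _ (by simp), h]
  · exact put_self _ _ _

theorem SafePair.reply (h : SafePair s w) (hk : w k = none) :
    ∃ k', put w k (!s) k' = none ∧ SafePair s (put (put w k !s) k' s) := by
  obtain h | ⟨h, -⟩ := h
  · have hne : (!k) ≠ k := by simp
    refine ⟨!k, by rw [put_of_ne _ _ hne, h], .inr ⟨fun l => ?_, !k, put_self _ _ _⟩⟩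
    obtain rfl | rfl := Bool.eq_or_eq_not l k
    · rw [put_of_ne _ _ hne.symm, put_self]
      simp
    · simp
  · exact (h k hk).elim

theorem SafePair.cases (h : SafePair s w) :
    (∀ k, w k = none) ∨ (∀ k, w k = some s) ∨ ∃ b, PairCode b w := by
  obtain h | ⟨h, k, hk⟩ := h
  · exact .inl h
  · obtain ⟨x, hx⟩ := Option.ne_none_iff_exists'.1 (h (!k))
    refine .inr ?_
    obtain rfl | rfl := Bool.eq_or_eq_not x s
    · refine .inl fun l => ?_
      obtain rfl | rfl := Bool.eq_or_eq_not l k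
      · exact hk
      · exact hx
    · cases k
      · exact .inr ⟨s, hk, hx⟩
      · exact .inr ⟨!s, hx, by simpa using hk⟩

theorem SafePair.exists_eq {w : Bool → Bool} (h : SafePair s fun k => some (w k)) :
    ∃ k, w k = s := by
  simpa [SafePair] using h

theorem pairCode_put (h : w k = some s) (hb : k = (b ^^ s)) : PairCode b (put w (!k) !s) := by
  subst hb
  cases b <;> cases s <;> simp_all [PairCode, put]

theorem PairCode.ne_none (h : PairCode b w) : w k ≠ none := by
  cases k <;> simp [h.1, h.2]

theorem PairCode.exists_eq {w : Bool → Bool} (h : PairCode b fun k => some (w k)) (s : Bool) :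
    ∃ k, w k = s := by
  simp only [PairCode, Option.some.injEq] at h
  obtain rfl | rfl := Bool.eq_or_eq_not b s
  · exact ⟨false, h.1⟩
  · exact ⟨true, by simpa using h.2⟩

theorem eq_not_of_eq_none {l : Bool} (hl : w l = some s) (hk : w k = none) : k = !l := by
  obtain rfl | rfl := Bool.eq_or_eq_not k l
  · simp [hl] at hk
  · rfl

theorem pairCanMoveTo_reply {E : Type}
    {P : (E → Option Bool) → (Bool → Option Bool) → (Bool → Option Bool) → Prop}
    {q : E → Option Bool} {z : Bool → Option Bool} (hw : SafePair s w) (hk : w k = none)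
    (hP : ∀ w, SafePair s w → P q z w) : PairCanMoveTo s P q z (put w k !s) := by
  obtain ⟨k', hk', h⟩ := hw.reply hk
  exact .inr (.inr ⟨k', hk', hP _ h⟩)

end Pairs

section ExtendSwitch

variable {ι : Type}

/-- A switch with the additional cells of `pairOutcome`. -/
abbrev extendSwitch (Φ : SetColoringGame (Outcome ι)) : SetColoringGame (Outcome (ι × Bool)) where
  carrier := Φ.carrier ⊕ Bool × Bool
  finite_carrier := have := Φ.finite_carrier; inferInstance
  payoff :=
    { toFun := fun w => pairOutcome (Φ.payoff (w ∘ Sum.inl)) fun t k => w (.inr (t, k))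
      monotone' := fun _ _ h =>
        (pairOutcome_mono_left (Φ.payoff.monotone fun c => h (.inl c))).trans
          (pairOutcome_mono_right _ fun t k => h (.inr (t, k))) }

variable (Φ : SetColoringGame (Outcome ι)) (s : Bool)

/-- Three ways in which `s` wins the extended switch: by a win in the original switch, with their
own cells, or by making the bit of the opponent invalid. -/
def PairWins (q : Φ.Position) (z w : Bool → Option Bool) : Prop :=
  (Secures Φ s (.ext s) q ∧ SafePair s w) ∨ ((∀ k, z k = some s) ∧ SafePair s w) ∨
    ((∃ j, Secures Φ s (.sym (!s) j) q) ∧ ∀ k, w k = some s)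

/-- The player `s` secures the symbol `i` and has chosen the bit `b`, or has colored the first of
the two cells of this bit, with a threat to color the second one and win. -/
def PairSecuresMine (i : ι) (b : Bool) (q : Φ.Position) (z w : Bool → Option Bool) : Prop :=
  SafePair s w ∧ ((Secures Φ s (.sym s i) q ∧ PairCode b z) ∨
    (CanReach s (Secures Φ s (.sym s i)) q ∧ z (b ^^ s) = some s ∧ z (!(b ^^ s)) = none))

/-- The invariant by which `s` secures the outcome `t` of the extended switch. -/
def PairSecures (t : Outcome (ι × Bool)) (q : Φ.Position) (z w : Bool → Option Bool) : Prop :=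
  PairWins Φ s q z w ∨ (∃ i b, t = .sym s (i, b) ∧ PairSecuresMine Φ s i b q z w) ∨
    ∃ j b, t = .sym (!s) (j, b) ∧ Secures Φ s (.sym (!s) j) q ∧ PairCode b w

variable {Φ s} {t : Outcome (ι × Bool)} {q : Φ.Position} {z w : Bool → Option Bool} {k : Bool}

theorem pairWins_put_opp {j : ι} (h : Secures Φ s (.sym (!s) j) q) (hk : w k = some s) :
    PairWins Φ s q z (put w (!k) s) :=
  .inr (.inr ⟨⟨j, h⟩, forall_put_eq hk⟩)

theorem pairWins_put_own (hw : SafePair s w) (hk : z k = some s) :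
    PairWins Φ s q (put z (!k) s) w :=
  .inr (.inl ⟨forall_put_eq hk, hw⟩)

theorem pairCanReach_of_canReach_ext (h : CanReach s (Secures Φ s (.ext s)) q)
    (hw : SafePair s w) : PairCanReach s (PairSecures Φ s t) q z w :=
  h.pair fun _ h => .inl (.inl ⟨h, hw⟩)

theorem PairSecures.move_core (h : PairSecures Φ s t q z w) {c : Φ.carrier} (hc : q c = none) :
    PairCanReach s (PairSecures Φ s t) (put q c !s) z w := by
  obtain (⟨h, hw⟩ | h | ⟨⟨j, h⟩, hw⟩) | ⟨i, b, rfl, hw, ⟨h, hb⟩ | ⟨-, hz, hz'⟩⟩ |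
    ⟨j, b, rfl, h, hb⟩ := h
  · exact pairCanReach_of_canReach_ext (h.move hc) hw
  · exact .inl (.inl (.inr (.inl h)))
  · exact (h.move hc).pair fun _ h => .inl (.inr (.inr ⟨⟨j, h⟩, hw⟩))
  · exact (h.move hc).pair fun _ h => .inr (.inl ⟨i, b, rfl, hw, .inl ⟨h, hb⟩⟩)
  · exact .inr (.inr (.inl ⟨_, hz', .inl (pairWins_put_own hw hz)⟩))
  · exact (h.move hc).pair fun _ h => .inr (.inr ⟨j, b, rfl, h, hb⟩)

theorem PairSecures.move_own (h : PairSecures Φ s t q z w) (hk : z k = none) :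
    PairCanReach s (PairSecures Φ s t) q (put z k !s) w := by
  obtain (h | ⟨hz, -⟩ | h) | ⟨i, b, rfl, hw, ⟨-, hb⟩ | ⟨h, hz, -⟩⟩ | h := h
  · exact .inl (.inl (.inl h))
  · simp [hz] at hk
  · exact .inl (.inl (.inr (.inr h)))
  · exact (hb.ne_none hk).elim
  · obtain rfl := eq_not_of_eq_none hz hk
    exact h.pair fun _ h => .inr (.inl ⟨i, b, rfl, hw, .inl ⟨h, pairCode_put hz rfl⟩⟩)
  · exact .inl (.inr (.inr h))

theorem PairSecures.move_opp (h : PairSecures Φ s t q z w) (hk : w k = none) :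
    PairCanReach s (PairSecures Φ s t) q z (put w k !s) := by
  obtain (⟨h, hw⟩ | ⟨h, hw⟩ | ⟨-, hw⟩) | ⟨i, b, rfl, hw, h⟩ | ⟨j, b, rfl, -, hb⟩ := h
  · exact .inr (pairCanMoveTo_reply hw hk fun w hw => .inl (.inl ⟨h, hw⟩))
  · exact .inr (pairCanMoveTo_reply hw hk fun w hw => .inl (.inr (.inl ⟨h, hw⟩)))
  · simp [hw] at hk
  · exact .inr (pairCanMoveTo_reply hw hk fun w hw => .inr (.inl ⟨i, b, rfl, hw, h⟩))
  · exact (hb.ne_none hk).elim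

theorem PairSecures.sideLe {w : Φ.carrier ⊕ Bool × Bool → Bool}
    (h : PairView s (PairSecures Φ s t) fun c => some (w c)) :
    PosetGame.sideLe s t ((extendSwitch Φ).payoff w) := by
  change PosetGame.sideLe s t (pairOutcome (Φ.payoff (w ∘ Sum.inl)) fun t k => w (.inr (t, k)))
  obtain (⟨h, hw⟩ | ⟨h, hw⟩ | ⟨⟨j, h⟩, hw⟩) | ⟨i, b, rfl, hw, ⟨h, hb⟩ | ⟨-, -, h⟩⟩ |
    ⟨j, b, rfl, h, hb⟩ := h
  · rw [show Φ.payoff (w ∘ Sum.inl) = .ext s from Outcome.eq_of_ext_sideLe h.sideLe,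
      pairOutcome_ext hw.exists_eq]
    exact Outcome.sideLe_ext
  · rw [pairOutcome_of_own (fun k => Option.some.inj (h k)) hw.exists_eq]
    exact Outcome.sideLe_ext
  · replace hw (k : Bool) : w (.inr (!s, k)) = s := Option.some.inj (hw k)
    obtain h | h : Φ.payoff (w ∘ Sum.inl) = _ ∨ _ := Outcome.eq_or_eq_of_sym_sideLe h.sideLe
    · rw [h, pairOutcome_theirs_of_all hw]
      exact Outcome.sideLe_ext
    · rw [h, pairOutcome_ext ⟨true, hw true⟩]
      exact Outcome.sideLe_ext
  · obtain h | h : Φ.payoff (w ∘ Sum.inl) = _ ∨ _ := Outcome.eq_or_eq_of_sym_sideLe h.sideLe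
    · rw [h]
      exact sideLe_pairOutcome_mine hw.exists_eq (Option.some.inj hb.1) (Option.some.inj hb.2) i
    · rw [h, pairOutcome_ext hw.exists_eq]
      exact Outcome.sideLe_ext
  · simp at h
  · obtain h | h : Φ.payoff (w ∘ Sum.inl) = _ ∨ _ := Outcome.eq_or_eq_of_sym_sideLe h.sideLe
    · rw [h]
      exact sideLe_pairOutcome_theirs (Option.some.inj hb.1) (Option.some.inj hb.2) j
    · rw [h, pairOutcome_ext (hb.exists_eq s)]
      exact Outcome.sideLe_ext

theorem secures_extendSwitch {q : (extendSwitch Φ).Position}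
    (h : PairView s (PairSecures Φ s t) q) : Secures (extendSwitch Φ) s t q :=
  secures_of_invariant (fun _ => PairSecures.sideLe)
    (fun _ _ h hc => canReach_pairView (pairView_move
      (R := PairCanReach s (PairSecures Φ s t)) (fun _ _ _ _ h hc => h.move_core hc)
      (fun _ _ _ _ h hk => h.move_own hk) (fun _ _ _ _ h hk => h.move_opp hk) h hc)) h

theorem canReach_secures_extendSwitch {q : (extendSwitch Φ).Position}
    (h : PairView s (PairCanReach s (PairSecures Φ s t)) q) :
    CanReach s (Secures (extendSwitch Φ) s t) q :=
  (canReach_pairView h).mono fun _ => secures_extendSwitch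

end ExtendSwitch

namespace SwitchStrategy

variable {ι : Type} {Φ : SetColoringGame (Outcome ι)} {s : Bool} {avail good : Set ι}

section

variable (σ : SwitchStrategy Φ s avail good)

/-- In a winning position of the extended switch, `s` threatens to win in the original switch or to
make the bit of the opponent invalid. -/
def PairWinning (q : Φ.Position) (_ w : Bool → Option Bool) : Prop :=
  (σ.winning q ∧ SafePair s w) ∨
    ((∃ j, Secures Φ s (.sym (!s) j) q) ∧ ∃ k, w k = some s ∧ w (!k) = none)

/-- In a calm position of the extended switch, `s` has not used their additional cells. -/
def PairCalm (q : Φ.Position) (z w : Bool → Option Bool) : Prop :=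
  σ.calm q ∧ (∀ k, z k = none) ∧ SafePair s w

/-- The conclusion of `SwitchStrategy.winning_move` for the extended switch. -/
def PairWinningReply (q : Φ.Position) (z w : Bool → Option Bool) : Prop :=
  PairCanReach s (PairSecures Φ s (.ext s)) q z w ∨
    (∃ j, PairSecures Φ s (.sym (!s) j) q z w) ∨ PairCanMoveTo s σ.PairWinning q z w

/-- The conclusion of `SwitchStrategy.calm_move` for the extended switch. -/
def PairCalmReply (q : Φ.Position) (z w : Bool → Option Bool) : Prop :=
  (∃ i ∈ {x : ι × Bool | x.1 ∈ good ∧ x.2 = false},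
      PairCanReach s (PairSecures Φ s (.sym s i)) q z w) ∨
    (∃ j, PairSecures Φ s (.sym (!s) j) q z w) ∨ PairCanMoveTo s σ.PairCalm q z w ∨
    PairCanMoveTo s σ.PairWinning q z w

end

variable {σ : SwitchStrategy Φ s avail good} {q : Φ.Position} {z w : Bool → Option Bool}

theorem pairReply_of_theirs {j : ι} (h : Secures Φ s (.sym (!s) j) q) (hw : SafePair s w) :
    (∀ t, PairSecures Φ s t q z w) ∨ (∃ j, PairSecures Φ s (.sym (!s) j) q z w) ∨
      PairCanMoveTo s σ.PairWinning q z w := by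
  obtain hw | hw | ⟨b, hb⟩ := hw.cases
  · refine .inr (.inr (.inr (.inr ⟨true, hw _, .inr ⟨⟨j, h⟩, true, put_self _ _ _, ?_⟩⟩)))
    rw [put_of_ne _ _ (by simp), hw]
  · exact .inl fun t => .inl (.inr (.inr ⟨⟨j, h⟩, hw⟩))
  · exact .inr (.inl ⟨(j, b), .inr (.inr ⟨j, b, rfl, h, hb⟩)⟩)

theorem pairCanMoveTo_secures_mine {i : ι} (h : CanReach s (Secures Φ s (.sym s i)) q)
    (hz : ∀ k, z k = none) (hw : SafePair s w) (b : Bool) :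
    PairCanMoveTo s (PairSecures Φ s (.sym s (i, b))) q z w := by
  refine .inr (.inl ⟨b ^^ s, hz _, .inr (.inl ⟨i, b, rfl, hw, .inr ⟨h, put_self _ _ _, ?_⟩⟩)⟩)
  rw [put_of_ne _ _ (by simp), hz]

theorem PairWinning.threat {z' : Bool → Option Bool} (h : σ.PairWinning q z' w) :
    PairCanReach s (PairSecures Φ s (.ext s)) q z w := by
  obtain ⟨h, hw⟩ | ⟨⟨j, h⟩, k, hk, hk'⟩ := h
  · exact pairCanReach_of_canReach_ext (σ.winning_threat q h) hw
  · exact .inr (.inr (.inr ⟨!k, hk', .inl (pairWins_put_opp h hk)⟩))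

theorem PairWinning.move_core {c : Φ.carrier} (h : σ.PairWinning q z w) (hc : q c = none) :
    σ.PairWinningReply (put q c !s) z w := by
  obtain ⟨h, hw⟩ | ⟨⟨j, h⟩, k, hk, hk'⟩ := h
  · obtain h | ⟨j, h⟩ | h := σ.winning_move q c h hc
    · exact .inl (pairCanReach_of_canReach_ext h hw)
    · exact (pairReply_of_theirs h hw).imp_left fun h => .inl (h _)
    · exact .inr (.inr (h.pair fun _ h => .inl ⟨h, hw⟩))
  · obtain h | h := h.move hc
    · exact .inl (.inr (.inr (.inr ⟨!k, hk', .inl (pairWins_put_opp h hk)⟩)))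
    · exact .inr (.inr (h.pair fun _ h => .inr ⟨⟨j, h⟩, k, hk, hk'⟩))

theorem PairWinning.move_opp {k : Bool} (h : σ.PairWinning q z w) (hk : w k = none) :
    σ.PairWinningReply q z (put w k !s) := by
  obtain ⟨h, hw⟩ | ⟨⟨j, h⟩, l, hl, -⟩ := h
  · exact .inr (.inr (pairCanMoveTo_reply hw hk fun _ hw => .inl ⟨h, hw⟩))
  · obtain rfl := eq_not_of_eq_none hl hk
    exact .inr (.inl ⟨(j, l ^^ s), .inr (.inr ⟨j, _, rfl, h, pairCode_put hl (by simp)⟩)⟩)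

theorem PairCalm.move_core {c : Φ.carrier} (h : σ.PairCalm q z w) (hc : q c = none) :
    σ.PairCalmReply (put q c !s) z w := by
  obtain ⟨h, hz, hw⟩ := h
  obtain ⟨i, hi, h⟩ | ⟨j, h⟩ | h | h := σ.calm_move q c h hc
  · exact .inl ⟨(i, false), ⟨hi, rfl⟩, .inr (pairCanMoveTo_secures_mine h hz hw false)⟩
  · obtain h' | h | h := pairReply_of_theirs (σ := σ) h hw
    · exact .inr (.inl ⟨(j, true), h' _⟩)
    · exact .inr (.inl h)
    · exact .inr (.inr (.inr h))
  · exact .inr (.inr (.inl (h.pair fun _ h => ⟨h, hz, hw⟩)))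
  · exact .inr (.inr (.inr (h.pair fun _ h => .inl ⟨h, hw⟩)))

theorem PairCalm.win (h : σ.PairCalm q z w) {z' : Bool → Option Bool} :
    PairCanMoveTo s σ.PairWinning q z' w :=
  (σ.calm_win q h.1).pair fun _ hq => .inl ⟨hq, h.2.2⟩

theorem PairCalm.move_own (h : σ.PairCalm q z w) {k : Bool} :
    σ.PairCalmReply q (put z k !s) w :=
  .inr (.inr (.inr h.win))

theorem PairCalm.move_opp {k : Bool} (h : σ.PairCalm q z w) (hk : w k = none) :
    σ.PairCalmReply q z (put w k !s) :=
  .inr (.inr (.inl (pairCanMoveTo_reply h.2.2 hk fun _ hw => ⟨h.1, h.2.1, hw⟩)))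

variable (σ) in
/-- The strategy in which `s` chooses an additional bit. -/
def extend : SwitchStrategy (extendSwitch Φ) s {x | x.1 ∈ avail}
    {x | x.1 ∈ good ∧ x.2 = false} where
  winning := PairView s σ.PairWinning
  calm := PairView s σ.PairCalm
  winning_threat _ h :=
    canReach_secures_extendSwitch (PairWinning.threat h)
  winning_move q c h hc := by
    have : PairView s σ.PairWinningReply (put q c !s) :=
      pairView_move (fun _ _ _ _ h hc => h.move_core hc) (fun _ _ _ _ h _ => .inl h.threat)
        (fun _ _ _ _ h hk => h.move_opp hk) h hc
    exact this.imp canReach_secures_extendSwitch (Or.imp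
      (fun ⟨j, h⟩ => ⟨j, secures_extendSwitch h⟩) canMoveTo_pairView)
  calm_choose := by
    rintro q ⟨h, hz, hw⟩ ⟨i, b⟩ hi
    exact canReach_secures_extendSwitch
      (.inr (pairCanMoveTo_secures_mine (σ.calm_choose _ h i hi) hz hw b))
  calm_win _ h := canMoveTo_pairView h.win
  calm_move q c h hc := by
    have : PairView s σ.PairCalmReply (put q c !s) :=
      pairView_move (fun _ _ _ _ h hc => h.move_core hc) (fun _ _ _ _ h _ => h.move_own)
        (fun _ _ _ _ h hk => h.move_opp hk) h hc
    exact this.imp (fun ⟨i, hi, h⟩ => ⟨i, hi, canReach_secures_extendSwitch h⟩) (Or.imp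
      (fun ⟨j, h⟩ => ⟨j, secures_extendSwitch h⟩) (Or.imp canMoveTo_pairView canMoveTo_pairView))
  calm_start := ⟨σ.calm_start, fun _ => rfl, .inl fun _ => rfl⟩

end SwitchStrategy

section HasSwitch

variable {O O' : Type*} [PartialOrder O] [PartialOrder O'] {ι κ : Type}

/-- The monotone map that relabels the symbols of a switch. -/
def Outcome.mapHom (f : ι → κ) : Outcome ι →o Outcome κ where
  toFun
    | .ext b => .ext b
    | .sym t i => .sym t (f i)
  monotone' := by
    rintro x y (rfl | rfl | rfl)
    · exact le_rfl
    · exact .inr (.inl rfl)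
    · exact .inr (.inr rfl)

/-- The set coloring game with the payoffs `f (Φ.payoff w)`. -/
abbrev mapPayoff (f : O →o O') (Φ : SetColoringGame O) : SetColoringGame O' where
  carrier := Φ.carrier
  finite_carrier := Φ.finite_carrier
  payoff := f.comp Φ.payoff

theorem Secures.mapPayoff (f : O →o O') {Φ : SetColoringGame O} {s : Bool} {t : O}
    {q : Φ.Position} (h : Secures Φ s t q) : Secures (mapPayoff f Φ) s (f t) q :=
  secures_of_invariant (Φ := PosetGame.mapPayoff f Φ) (P := Secures Φ s t)
    (fun _ h => by have := h.sideLe; cases s <;> exact f.monotone this) (fun _ _ h => h.move) h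

/-- The strategy for a switch whose symbols have been relabelled. -/
def SwitchStrategy.map (f : ι → κ) {Φ : SetColoringGame (Outcome ι)} {s : Bool}
    {avail good : Set ι} (σ : SwitchStrategy Φ s avail good) {avail' good' : Set κ}
    (h_avail : avail' ⊆ f '' avail) (h_good : Set.MapsTo f good good') :
    SwitchStrategy (mapPayoff (Outcome.mapHom f) Φ) s avail' good' where
  winning := σ.winning
  calm := σ.calm
  winning_threat q h := (σ.winning_threat q h).mono fun _ h => h.mapPayoff _
  winning_move q c h hc := (σ.winning_move q c h hc).imp (·.mono fun _ h => h.mapPayoff _)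
    (Or.imp_left fun ⟨j, h⟩ => ⟨f j, h.mapPayoff _⟩)
  calm_choose q h x hx := by
    obtain ⟨i, hi, rfl⟩ := h_avail hx
    exact (σ.calm_choose q h i hi).mono fun _ h => h.mapPayoff _
  calm_win := σ.calm_win
  calm_move q c h hc := (σ.calm_move q c h hc).imp
    (fun ⟨i, hi, h⟩ => ⟨f i, h_good hi, h.mono fun _ h => h.mapPayoff _⟩)
    (Or.imp_left fun ⟨j, h⟩ => ⟨f j, h.mapPayoff _⟩)
  calm_start := σ.calm_start

/-- There is a switch with `n` cells in which each player `s` can choose among the symbols in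
`avail s` or, if the opponent moves first, secure one of the symbols in `good s`. -/
def HasSwitch (n : ℕ) (ι : Type) (avail good : Bool → Set ι) : Prop :=
  ∃ Φ : SetColoringGame (Outcome ι), Φ.size = n ∧
    ∀ s, Nonempty (SwitchStrategy Φ s (avail s) (good s))

variable {n : ℕ} {avail good : Bool → Set ι}

theorem HasSwitch.map (h : HasSwitch n ι avail good) (f : ι → κ) {avail' good' : Bool → Set κ}
    (h_avail : ∀ s, avail' s ⊆ f '' avail s) (h_good : ∀ s, Set.MapsTo f (good s) (good' s)) :
    HasSwitch n κ avail' good' := by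
  obtain ⟨Φ, hΦ, hσ⟩ := h
  exact ⟨mapPayoff (Outcome.mapHom f) Φ, hΦ,
    fun s => (hσ s).map (·.map f (h_avail s) (h_good s))⟩

theorem HasSwitch.addBit (h : HasSwitch n ι avail good) :
    HasSwitch (n + 4) (ι × Bool) (fun s => {x | x.1 ∈ avail s})
      (fun s => {x | x.1 ∈ good s ∧ x.2 = false}) := by
  obtain ⟨Φ, rfl, hσ⟩ := h
  refine ⟨extendSwitch Φ, ?_, fun s => (hσ s).map (·.extend)⟩
  have := Φ.finite_carrier
  simp [SetColoringGame.size, Nat.card_sum]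

theorem HasSwitch.addBits (h : HasSwitch n ι avail good) (k : ℕ) :
    HasSwitch (n + 4 * k) (ι × ℕ) (fun s => {x | x.1 ∈ avail s ∧ x.2 < 2 ^ k})
      (fun s => {x | x.1 ∈ good s ∧ x.2 = 0}) := by
  induction k with
  | zero =>
    refine h.map (fun i => (i, 0)) (fun s => ?_) fun s i hi => ⟨hi, rfl⟩
    rintro ⟨i, m⟩ ⟨hi, hm⟩
    exact ⟨i, hi, by simpa [eq_comm] using hm⟩
  | succ k ih =>
    refine ih.addBit.map (fun x => (x.1.1, x.1.2.bit x.2)) (fun s => ?_) fun s => ?_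
    · rintro ⟨i, m⟩ ⟨hi, hm⟩
      have hm' : m / 2 < 2 ^ k := by rw [pow_succ] at hm; omega
      exact ⟨((i, m / 2), m.testBit 0), ⟨hi, hm'⟩,
        Prod.ext rfl (Nat.shiftRight_one m ▸ Nat.bit_testBit_zero_shiftRight_one m)⟩
    · rintro ⟨⟨i, m⟩, b⟩ ⟨⟨hi, rfl⟩, rfl⟩
      exact ⟨hi, rfl⟩

end HasSwitch

section Dual

variable {ι : Type}

/-- The position with the colors exchanged. -/
def swapColors {E : Type} (q : E → Option Bool) : E → Option Bool := fun c => (q c).map not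

section

variable {E : Type} {s : Bool} {P : (E → Option Bool) → Prop} {q : E → Option Bool}

theorem swapColors_put (q : E → Option Bool) (c : E) (s : Bool) :
    swapColors (put q c s) = put (swapColors q) c !s := by
  ext1 d
  by_cases h : d = c
  · subst h; simp only [swapColors, put_self, Option.map_some]
  · simp only [swapColors, put_of_ne _ _ h]

theorem swapColors_eq_none {c : E} : swapColors q c = none ↔ q c = none := Option.map_eq_none_iff

theorem canMoveTo_swapColors :
    CanMoveTo s P (swapColors q) ↔ CanMoveTo (!s) (fun q => P (swapColors q)) q := by
  simp only [CanMoveTo, swapColors_eq_none, swapColors_put, Bool.not_not]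

theorem canReach_swapColors :
    CanReach s P (swapColors q) ↔ CanReach (!s) (fun q => P (swapColors q)) q :=
  or_congr_right canMoveTo_swapColors

end

/-- The outcome with the players exchanged. -/
def Outcome.swap : Outcome ι → Outcome ι
  | ext b => ext !b
  | sym t i => sym (!t) i

theorem Outcome.sideLe_swap {s : Bool} {x y : Outcome ι} (h : sideLe s x y) :
    sideLe (!s) x.swap y.swap := by
  obtain rfl | rfl | rfl := sideLe_iff.1 h
  · exact sideLe_refl _ _
  · exact ext_not_sideLe
  · exact sideLe_ext

/-- The switch with the players exchanged. -/
abbrev dualSwitch (Φ : SetColoringGame (Outcome ι)) : SetColoringGame (Outcome ι) where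
  carrier := Φ.carrier
  finite_carrier := Φ.finite_carrier
  payoff := ⟨fun w => (Φ.payoff fun c => !w c).swap, fun _ _ hvw =>
    Outcome.sideLe_swap (s := false) (Φ.payoff.monotone fun c => compl_le_compl (hvw c))⟩

variable {Φ : SetColoringGame (Outcome ι)} {s : Bool}

theorem Secures.dual {t : Outcome ι} {q : Φ.Position} (h : Secures Φ (!s) t (swapColors q)) :
    Secures (dualSwitch Φ) s t.swap q := by
  refine secures_of_invariant (Φ := dualSwitch Φ) (P := fun q => Secures Φ (!s) t (swapColors q))
    (fun w h => ?_) (fun q c h hc => ?_) h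
  · exact Bool.not_not s ▸ Outcome.sideLe_swap (Secures.sideLe h)
  · have := h.move (swapColors_eq_none.2 hc)
    rwa [← swapColors_put, canReach_swapColors, Bool.not_not] at this

theorem CanReach.dual {t : Outcome ι} {q : Φ.Position}
    (h : CanReach (!s) (Secures Φ (!s) t) (swapColors q)) :
    CanReach s (Secures (dualSwitch Φ) s t.swap) q := by
  rw [canReach_swapColors, Bool.not_not] at h
  exact h.mono fun q h => h.dual

theorem CanMoveTo.dual {P : Φ.Position → Prop} {q : Φ.Position}
    (h : CanMoveTo (!s) P (swapColors q)) :
    CanMoveTo s (fun q => P (swapColors q)) q := by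
  rwa [canMoveTo_swapColors, Bool.not_not] at h

/-- The strategy with the players exchanged. -/
def SwitchStrategy.dual {avail good : Set ι} (σ : SwitchStrategy Φ (!s) avail good) :
    SwitchStrategy (dualSwitch Φ) s avail good where
  winning q := σ.winning (swapColors q)
  calm q := σ.calm (swapColors q)
  winning_threat q h := by simpa [Outcome.swap] using (σ.winning_threat _ h).dual
  winning_move q c h hc := by
    have := σ.winning_move _ c h (swapColors_eq_none.2 hc)
    rw [← swapColors_put] at this
    refine this.imp (fun h => ?_) (Or.imp (fun ⟨j, h⟩ => ⟨j, ?_⟩) CanMoveTo.dual)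
    · simpa [Outcome.swap] using h.dual
    · simpa [Outcome.swap] using h.dual
  calm_choose q h i hi := by simpa [Outcome.swap] using (σ.calm_choose _ h i hi).dual
  calm_win q h := (σ.calm_win _ h).dual
  calm_move q c h hc := by
    have := σ.calm_move _ c h (swapColors_eq_none.2 hc)
    rw [← swapColors_put] at this
    refine this.imp (fun ⟨i, hi, h⟩ => ⟨i, hi, ?_⟩) (Or.imp (fun ⟨j, h⟩ => ⟨j, ?_⟩)
      (Or.imp CanMoveTo.dual CanMoveTo.dual))
    · simpa [Outcome.swap] using h.dual
    · simpa [Outcome.swap] using h.dual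
  calm_start := σ.calm_start

theorem HasSwitch.dual {n : ℕ} {avail good : Bool → Set ι} (h : HasSwitch n ι avail good) :
    HasSwitch n ι (fun s => avail !s) (fun s => good !s) := by
  obtain ⟨Φ, hΦ, hσ⟩ := h
  exact ⟨dualSwitch Φ, hΦ, fun s => (hσ !s).map SwitchStrategy.dual⟩

end Dual

/-! ### Checking strategies by computation -/

section Check

/-- Whether `s` can move to a position accepted by `P`. For computation, a position with finitely
many cells is represented by the list of the states of its cells. -/
def anyMove (s : Bool) : (List (Option Bool) → Bool) → List (Option Bool) → Bool
  | _, [] => false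
  | P, none :: l => P (some s :: l) || anyMove s (fun l' => P (none :: l')) l
  | P, some b :: l => anyMove s (fun l' => P (some b :: l')) l

/-- Whether every move of `s` leads to a position accepted by `P`. -/
def allMoves (s : Bool) (P : List (Option Bool) → Bool) (l : List (Option Bool)) : Bool :=
  !anyMove s (fun l' => !P l') l

theorem anyMove_ofFn {s : Bool} {n : ℕ} {P : List (Option Bool) → Bool} {q : Fin n → Option Bool} :
    anyMove s P (List.ofFn q) = true ↔ CanMoveTo s (fun q => P (List.ofFn q) = true) q := by
  induction n generalizing P with
  | zero => simp [anyMove, CanMoveTo]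
  | succ n ih =>
    have h_tail (c : Fin n) : (fun i : Fin n => put q c.succ s i.succ) =
        put (fun i => q i.succ) c s := by
      ext1 i
      by_cases h : i = c
      · subst h; simp only [put_self]
      · rw [put_of_ne _ _ h, put_of_ne _ _ (by simpa using h)]
    have h_head : (fun i : Fin n => put q 0 s i.succ) = fun i => q i.succ :=
      funext fun i => put_of_ne _ _ (Fin.succ_ne_zero i)
    have h_zero (c : Fin n) : put q c.succ s 0 = q 0 := put_of_ne _ _ (Fin.succ_ne_zero c).symm
    simp only [CanMoveTo, Fin.exists_fin_succ, List.ofFn_succ, put_self, h_tail, h_head, h_zero]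
    cases q 0 <;> simp [anyMove, ih, CanMoveTo]

theorem allMoves_ofFn {s : Bool} {n : ℕ} {P : List (Option Bool) → Bool}
    {q : Fin n → Option Bool} : allMoves s P (List.ofFn q) = true ↔
      ∀ c, q c = none → P (List.ofFn (put q c s)) = true := by
  rw [allMoves, Bool.not_eq_true', ← Bool.not_eq_true, anyMove_ofFn]
  simp [CanMoveTo]

/-- The coloring in which `b` receives all empty cells. -/
def fill (b : Bool) (l : List (Option Bool)) : List Bool := l.map (·.getD b)

instance {ι : Type} [DecidableEq ι] (s : Bool) (x y : Outcome ι) : Decidable (sideLe s x y) :=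
  decidable_of_iff _ Outcome.sideLe_iff.symm

variable {ι : Type} [DecidableEq ι]

/-- Whether `φ` is below `ψ` and both are monotone on lists of length `n`. -/
def checkMonotone : ℕ → (List Bool → Outcome ι) → (List Bool → Outcome ι) → Bool
  | 0, φ, ψ => decide (sideLe true (φ []) (ψ []))
  | n + 1, φ, ψ => checkMonotone n (fun l => φ (false :: l)) (fun l => ψ (false :: l)) &&
      checkMonotone n (fun l => φ (false :: l)) (fun l => ψ (true :: l)) &&
      checkMonotone n (fun l => φ (true :: l)) (fun l => ψ (true :: l))

theorem le_of_checkMonotone {n : ℕ} {φ ψ : List Bool → Outcome ι}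
    (h : checkMonotone n φ ψ = true) {v w : Fin n → Bool} (hvw : v ≤ w) :
    φ (List.ofFn v) ≤ ψ (List.ofFn w) := by
  induction n generalizing φ ψ with
  | zero => exact of_decide_eq_true (p := sideLe true (φ []) (ψ [])) h
  | succ n ih =>
    simp only [checkMonotone, Bool.and_eq_true] at h
    have h_tail : (fun i : Fin n => v i.succ) ≤ fun i => w i.succ := fun i => hvw i.succ
    have h_head := hvw 0
    rw [List.ofFn_succ, List.ofFn_succ]
    cases hv : v 0 <;> cases hw : w 0
    · exact ih h.1.1 h_tail
    · exact ih h.1.2 h_tail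
    · rw [hv, hw] at h_head
      exact absurd (h_head rfl) Bool.false_ne_true
    · exact ih h.2 h_tail

/-- The switch with cells `Fin n` whose payoff at a coloring is the value of `φ` at the list of its
colors. -/
abbrev listSwitch {n : ℕ} {φ : List Bool → Outcome ι} (h : checkMonotone n φ φ = true) :
    SetColoringGame (Outcome ι) where
  carrier := Fin n
  finite_carrier := inferInstance
  payoff := ⟨fun w => φ (List.ofFn w), fun _ _ hvw => le_of_checkMonotone h hvw⟩

variable (φ : List Bool → Outcome ι) (s : Bool)

/-- Whether the payoff is at least `t` for `s` even if the opponent receives all empty cells. -/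
def guarantees (t : Outcome ι) (l : List (Option Bool)) : Bool :=
  decide (sideLe s t (φ (fill (!s) l)))

/-- Whether `s` secures `t` with the opponent to move, within `k` rounds. -/
def checkSecures (t : Outcome ι) : ℕ → List (Option Bool) → Bool
  | 0, l => guarantees φ s t l
  | k + 1, l => guarantees φ s t l ||
      (decide (sideLe s t (φ (fill s l))) &&
        allMoves (!s) (fun l' => guarantees φ s t l' || anyMove s (checkSecures t k) l') l)

/-- Whether `s` secures `t` with `s` to move, within `k` rounds. -/
def checkReach (t : Outcome ι) (k : ℕ) (l : List (Option Bool)) : Bool :=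
  guarantees φ s t l || anyMove s (checkSecures φ s t k) l

/-- Whether `l` is winning in the sense of `SwitchStrategy`, within `k` rounds, where `theirs` lists
symbols of the opponent. -/
def checkWinning (theirs : List ι) : ℕ → List (Option Bool) → Bool
  | 0, _ => false
  | k + 1, l => checkReach φ s (.ext s) k l &&
      allMoves (!s) (fun l' => anyMove s (checkWinning theirs k) l' ||
        checkReach φ s (.ext s) k l' ||
        theirs.any (fun j => checkSecures φ s (.sym (!s) j) k l')) l

/-- Whether `l` is calm in the sense of `SwitchStrategy`, within `k` rounds. -/
def checkCalm (avail good theirs : List ι) : ℕ → List (Option Bool) → Bool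
  | 0, _ => false
  | k + 1, l => anyMove s (checkWinning φ s theirs k) l &&
      avail.all (fun i => checkReach φ s (.sym s i) k l) &&
      allMoves (!s) (fun l' => anyMove s (checkCalm avail good theirs k) l' ||
        good.any (fun i => checkReach φ s (.sym s i) k l') ||
        theirs.any (fun j => checkSecures φ s (.sym (!s) j) k l') ||
        anyMove s (checkWinning φ s theirs k) l') l

variable {φ s} {n k : ℕ} {t : Outcome ι} {q : Fin n → Option Bool} {theirs : List ι}

theorem fill_ofFn (b : Bool) : fill b (List.ofFn q) = List.ofFn fun c => (q c).getD b :=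
  List.map_ofFn

theorem guarantees_ofFn :
    guarantees φ s t (List.ofFn q) = true ↔
      sideLe s t (φ (List.ofFn fun c => (q c).getD !s)) := by
  rw [guarantees, decide_eq_true_eq, fill_ofFn]

variable (hφ : checkMonotone n φ φ = true)
include hφ

theorem secures_of_guarantees (h : guarantees φ s t (List.ofFn q) = true) :
    Secures (listSwitch hφ) s t q := by
  refine secures_of_invariant (Φ := listSwitch hφ)
    (P := fun q => sideLe s t (φ (List.ofFn fun c => (q c).getD !s)))
    (fun w h => h) (fun q c h hc => .inl ?_) (guarantees_ofFn.1 h)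
  have h_fill : (fun d => (put q c (!s) d).getD !s) = fun d => (q d).getD !s := by
    ext1 d
    by_cases hd : d = c
    · subst hd; rw [put_self, hc]; rfl
    · rw [put_of_ne _ _ hd]
  rwa [← h_fill] at h

theorem secures_of_checkSecures (h : checkSecures φ s t k (List.ofFn q) = true) :
    Secures (listSwitch hφ) s t q := by
  induction k generalizing q with
  | zero => exact secures_of_guarantees hφ h
  | succ k ih =>
    simp only [checkSecures, Bool.or_eq_true, Bool.and_eq_true, decide_eq_true_eq, fill_ofFn,
      allMoves_ofFn, anyMove_ofFn] at h
    obtain h | ⟨h_end, h_move⟩ := h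
    · exact secures_of_guarantees hφ h
    · refine secures_of_moves (Φ := listSwitch hφ) (fun w hw => by subst hw; exact h_end)
        fun c hc => ?_
      exact (h_move c hc).imp (secures_of_guarantees hφ) fun h => h.mono fun q h => ih h

theorem canReach_of_checkReach (h : checkReach φ s t k (List.ofFn q) = true) :
    CanReach s (Secures (listSwitch hφ) s t) q := by
  rw [checkReach, Bool.or_eq_true, anyMove_ofFn] at h
  exact h.imp (secures_of_guarantees hφ) fun h => h.mono fun q h => secures_of_checkSecures hφ h

theorem checkWinning_imp (h : checkWinning φ s theirs k (List.ofFn q) = true) :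
    CanReach s (Secures (listSwitch hφ) s (.ext s)) q ∧
      ∀ c, q c = none → CanReach s (Secures (listSwitch hφ) s (.ext s)) (put q c !s) ∨
        (∃ j, Secures (listSwitch hφ) s (.sym (!s) j) (put q c !s)) ∨
        CanMoveTo s (fun q => ∃ k, checkWinning φ s theirs k (List.ofFn q) = true)
          (put q c !s) := by
  obtain _ | k := k
  · simp [checkWinning] at h
  simp only [checkWinning, Bool.and_eq_true, Bool.or_eq_true, allMoves_ofFn, anyMove_ofFn,
    List.any_eq_true] at h
  refine ⟨canReach_of_checkReach hφ h.1, fun c hc => ?_⟩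
  obtain (h | h) | ⟨j, -, h⟩ := h.2 c hc
  · exact .inr (.inr (h.mono fun q h => ⟨k, h⟩))
  · exact .inl (canReach_of_checkReach hφ h)
  · exact .inr (.inl ⟨j, secures_of_checkSecures hφ h⟩)

theorem checkCalm_imp {avail good : List ι}
    (h : checkCalm φ s avail good theirs k (List.ofFn q) = true) :
    CanMoveTo s (fun q => ∃ k, checkWinning φ s theirs k (List.ofFn q) = true) q ∧
      (∀ i ∈ avail, CanReach s (Secures (listSwitch hφ) s (.sym s i)) q) ∧
      ∀ c, q c = none →
        (∃ i ∈ good, CanReach s (Secures (listSwitch hφ) s (.sym s i)) (put q c !s)) ∨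
        (∃ j, Secures (listSwitch hφ) s (.sym (!s) j) (put q c !s)) ∨
        CanMoveTo s (fun q => ∃ k, checkCalm φ s avail good theirs k (List.ofFn q) = true)
          (put q c !s) ∨
        CanMoveTo s (fun q => ∃ k, checkWinning φ s theirs k (List.ofFn q) = true)
          (put q c !s) := by
  obtain _ | k := k
  · simp [checkCalm] at h
  simp only [checkCalm, Bool.and_eq_true, Bool.or_eq_true, allMoves_ofFn, anyMove_ofFn,
    List.any_eq_true, List.all_eq_true] at h
  refine ⟨h.1.1.mono fun q h => ⟨k, h⟩,
    fun i hi => canReach_of_checkReach hφ (h.1.2 i hi), fun c hc => ?_⟩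
  obtain ((h | ⟨i, hi, h⟩) | ⟨j, -, h⟩) | h := h.2 c hc
  · exact .inr (.inr (.inl (h.mono fun q h => ⟨k, h⟩)))
  · exact .inl ⟨i, hi, canReach_of_checkReach hφ h⟩
  · exact .inr (.inl ⟨j, secures_of_checkSecures hφ h⟩)
  · exact .inr (.inr (.inr (h.mono fun q h => ⟨k, h⟩)))

/-- The strategy found by `checkCalm`. -/
def SwitchStrategy.ofCheckCalm {avail good : List ι}
    (h : checkCalm φ s avail good theirs n (List.replicate n none) = true) :
    SwitchStrategy (listSwitch hφ) s {i | i ∈ avail} {i | i ∈ good} where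
  winning q := ∃ k, checkWinning φ s theirs k (List.ofFn q) = true
  calm q := ∃ k, checkCalm φ s avail good theirs k (List.ofFn q) = true
  winning_threat := fun _ ⟨_, h⟩ => (checkWinning_imp hφ h).1
  winning_move := fun _ c ⟨_, h⟩ => (checkWinning_imp hφ h).2 c
  calm_choose := fun _ ⟨_, h⟩ => (checkCalm_imp hφ h).2.1
  calm_win := fun _ ⟨_, h⟩ => (checkCalm_imp hφ h).1
  calm_move := fun _ c ⟨_, h⟩ => (checkCalm_imp hφ h).2.2 c
  calm_start := ⟨n, by rwa [List.ofFn_const]⟩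

end Check

/-! ### Two small switches -/

/-- The outcome that results from two cells with which the player `t` chooses between two of their
symbols. -/
def choice {ι : Type} (t : Bool) (i j : ι) : Bool → Bool → Outcome ι
  | false, false => .ext false
  | true, false => .sym t i
  | false, true => .sym t j
  | true, true => .ext true

/-- The payoff function of a switch with two symbols for each player. It was found by computer
search. The player `false` chooses with `p₀` and `p₁`, and the player `true` with `q₀` and `q₁`. -/
def twoSymbolPayoff : List Bool → Outcome Bool
  | [x, y, z, p₀, p₁, q₀, q₁] =>
    let ρ := choice false false true p₀ p₁
    let l := choice true false true q₀ q₁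
    match y, z with
    | false, false => bif (bif x then q₀ || q₁ else q₀ && q₁) then ρ else .ext false
    | true, true => bif (bif x then p₀ || p₁ else p₀ && p₁) then .ext true else l
    | _, z => bif (bif z then p₀ && q₀ || p₁ && q₁ else (p₀ || q₀) && (p₁ || q₁))
        then (bif x then .ext true else l)
        else (bif x then ρ else .ext false)
  | _ => .ext false

theorem checkMonotone_twoSymbolPayoff :
    checkMonotone 7 twoSymbolPayoff twoSymbolPayoff = true := by
  decide +kernel

theorem checkCalm_twoSymbolPayoff (s : Bool) :
    checkCalm twoSymbolPayoff s [false, true] [false, true] [false, true] 7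
      (List.replicate 7 none) = true := by
  cases s <;> decide +kernel

theorem hasSwitch_bool : HasSwitch 7 Bool (fun _ => Set.univ) (fun _ => Set.univ) := by
  have h_univ : Set.univ = {i | i ∈ [false, true]} := by ext i; simp
  refine ⟨listSwitch checkMonotone_twoSymbolPayoff, Nat.card_fin 7, fun s => ⟨?_⟩⟩
  rw [h_univ]
  exact SwitchStrategy.ofCheckCalm _ (checkCalm_twoSymbolPayoff s)

/-- The payoff function of a switch in which the player `false` is favored. It was found by
computer search. The player `false` chooses with `p₀` and `p₁`, and the player `true` with `q₀`
and `q₁`, where the symbol `2` takes the place of `0` in a single row. -/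
def biasedSwitchPayoff : List Bool → Outcome (Fin 3)
  | [w, x, y, z, p₀, p₁, q₀, q₁] =>
    let ρ := choice false 0 1 p₀ p₁
    let l := choice true 0 1 q₀ q₁
    match w, x, y, z with
    | false, false, false, _ => bif q₀ && q₁ then ρ else .ext false
    | false, false, true, false =>
      bif (bif p₀ && p₁ then q₀ || q₁ else q₀ && q₁ && (p₀ || p₁)) then l else .ext false
    | false, false, true, true => bif p₀ && q₀ || p₁ && q₁ then .ext true else .ext false
    | false, true, false, false => bif q₀ && q₁ then .ext true else .ext false
    | false, true, false, true =>
      bif (p₀ || q₁) && (p₁ || q₀) then choice true 2 1 q₀ q₁ else .ext false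
    | false, true, true, false => bif (p₀ || q₀) && (p₁ || q₁) then l else .ext false
    | false, true, true, true => bif (p₀ || q₁) && (p₁ || q₀) then .ext true else l
    | true, false, false, false => bif (p₀ || q₁) && (p₁ || q₀) then ρ else .ext false
    | true, false, false, true => bif p₀ && q₁ || p₁ && q₀ then .ext true else ρ
    | true, false, true, false => bif p₀ && q₀ || p₁ && q₁ then .ext true else ρ
    | true, true, true, true => bif p₀ || p₁ then .ext true else l
    | true, _, _, _ =>
      bif (bif p₀ || p₁ then p₀ && p₁ || q₀ || q₁ else q₀ && q₁) then .ext true else ρ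
  | _ => .ext false

theorem checkMonotone_biasedSwitchPayoff :
    checkMonotone 8 biasedSwitchPayoff biasedSwitchPayoff = true := by
  decide +kernel

theorem checkCalm_biasedSwitchPayoff_false :
    checkCalm biasedSwitchPayoff false [0, 1] [0, 1] [0, 1, 2] 8
      (List.replicate 8 none) = true := by
  decide +kernel

theorem checkCalm_biasedSwitchPayoff_true :
    checkCalm biasedSwitchPayoff true [0, 1, 2] [1, 2] [0, 1] 8 (List.replicate 8 none) = true := by
  decide +kernel

/-- The symbols that the player `s` can choose in a switch in which the player `g` is favored. -/
def biasedAvail (g s : Bool) : Set (Fin 3) := {i | s = g → i ≠ 2}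

/-- The symbols that the player `s` can secure, if the opponent moves first, in a switch in which
the player `g` is favored. -/
def biasedGood (g s : Bool) : Set (Fin 3) := {i | if s = g then i ≠ 2 else i ≠ 0}

theorem hasSwitch_biased (g : Bool) : HasSwitch 8 (Fin 3) (biasedAvail g) (biasedGood g) := by
  have h_false : HasSwitch 8 (Fin 3) (biasedAvail false) (biasedGood false) := by
    refine ⟨listSwitch checkMonotone_biasedSwitchPayoff, Nat.card_fin 8, fun s => ⟨?_⟩⟩
    cases s
    · have h_avail : biasedAvail false false = {i | i ∈ [0, 1]} := by
        ext i; fin_cases i <;> simp [biasedAvail]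
      have h_good : biasedGood false false = {i | i ∈ [0, 1]} := by
        ext i; fin_cases i <;> simp [biasedGood]
      rw [h_avail, h_good]
      exact SwitchStrategy.ofCheckCalm _ checkCalm_biasedSwitchPayoff_false
    · have h_avail : biasedAvail false true = {i | i ∈ [0, 1, 2]} := by
        ext i; fin_cases i <;> simp [biasedAvail]
      have h_good : biasedGood false true = {i | i ∈ [1, 2]} := by
        ext i; fin_cases i <;> simp [biasedGood]
      rw [h_avail, h_good]
      exact SwitchStrategy.ofCheckCalm _ checkCalm_biasedSwitchPayoff_true
  cases g
  · exact h_false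
  · convert h_false.dual using 1 <;> ext s i <;> cases s <;> simp [biasedAvail, biasedGood]

theorem exists_mem_biasedAvail_inter_biasedGood (g s b : Bool) :
    ∃ i ∈ biasedAvail g s ∩ biasedGood g s, decide (i = 1) = b := by
  simp only [biasedAvail, biasedGood, Set.mem_inter_iff, Set.mem_ofPred_eq]
  revert g s b
  decide

/-! ### Realizability -/

section Realizable

variable {A : Type u} [PartialOrder A]

theorem SetColoringGame.equivalent_value (S T : SetColoringGame A) (f : S.carrier → T.carrier)
    (hf : Function.Injective f) (h : ∀ w, S.payoff (w ∘ f) = T.payoff w) :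
    S.value.Equivalent T.value :=
  equivalent_iff_sLe.2 fun s => positionValue_sLe f hf (fun w => h w ▸ sideLe_refl _ _)
    fun _ => CellLe.refl s _

theorem Game.RealizableWithSize.exists_payoff {G : Game A} {m n : ℕ}
    (h : G.RealizableWithSize m) (hmn : m ≤ n) :
    ∃ p : (Fin n → Bool) →o A, G.Equivalent (cellGame p).value := by
  obtain ⟨S, hS, hG⟩ := h
  have := S.finite_carrier
  let f : S.carrier → Fin n := Fin.castLE hmn ∘ (Finite.equivFin S.carrier).trans (finCongr hS)
  have hf : Function.Injective f := (Fin.castLE_injective hmn).comp (Equiv.injective _)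
  exact ⟨⟨fun w => S.payoff (w ∘ f), fun v w hvw => S.payoff.monotone fun c => hvw _⟩,
    hG.trans (S.equivalent_value _ f hf fun w => rfl)⟩

theorem Game.RealizableWithSize.mono {G : Game A} {m n : ℕ} (h : G.RealizableWithSize m)
    (hmn : m ≤ n) : G.RealizableWithSize n := by
  obtain ⟨p, hp⟩ := h.exists_payoff hmn
  exact ⟨cellGame p, Nat.card_fin n, hp⟩

theorem Game.IsAtomic.realizableWithSize_zero {G : Game A} (h : G.IsAtomic) :
    G.RealizableWithSize 0 := by
  obtain ⟨a, rfl⟩ := h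
  let S : SetColoringGame A := cellGame (OrderHom.const (Fin 0 → Bool) a)
  have h_empty : (fun _ : Fin 0 => none) = fun c : Fin 0 => some (c.elim0 : Bool) :=
    funext fun c => c.elim0
  have hS : S.value = atom a := (congrArg S.positionValue h_empty).trans (S.positionValue_some _)
  exact ⟨S, Nat.card_fin 0, hS ▸ equivalent_iff_sLe.2 fun s => SLe.refl s _⟩

theorem HasSwitch.realizableWithSize [BoundedOrder A] {G : Game A} {N : ℕ} {ι Z : Type} [Finite Z]
    {avail good : Bool → Set ι}
    (h : HasSwitch N ι avail good) (pay : Bool → ι → (Z → Bool) →o A) (hG : ¬ G.IsAtomic)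
    (h_mine : ∀ s, ∀ K ∈ opts s G, ∃ i ∈ avail s, SLe s K (cellGame (pay s i)).value)
    (h_theirs : ∀ s j, STri s G (cellGame (pay (!s) j)).value)
    (h_good : ∀ s, ∀ i ∈ good s, SLe s G (cellGame (pay s i)).value)
    (h_cell : ∀ s (c : Z), ∃ i ∈ avail s,
      SLe s G ((cellGame (pay s i)).positionValue (put (emptyPosition Z) c !s))) :
    G.RealizableWithSize (N + Nat.card Z) := by
  obtain ⟨Φ, rfl, hσ⟩ := h
  have := Φ.finite_carrier
  refine ⟨switchGame Φ pay, Nat.card_sum, equivalent_iff_sLe.2 fun s => ?_⟩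
  obtain ⟨σ⟩ := hσ s
  exact σ.sLe_value_switchGame hG (h_mine s) (h_theirs s) (h_good s) (h_cell s)

end Realizable

/-! ### Realizing one composite game -/

theorem exists_enumeration {α : Type*} {S : Set α} (hS : S.Finite) {x₀ : α} (hx₀ : x₀ ∈ S)
    {N : ℕ} (hN : S.ncard ≤ N) :
    ∃ f : ℕ → α, f 0 = x₀ ∧ (∀ m, f m ∈ S) ∧ ∀ x ∈ S, ∃ m < N, f m = x := by
  have := hS.to_subtype
  have h_pos : 0 < S.ncard := (Set.ncard_pos hS).2 ⟨x₀, hx₀⟩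
  let e : S ≃ Fin S.ncard := Finite.equivFin S
  let e' := e.trans (Equiv.swap (e ⟨x₀, hx₀⟩) ⟨0, h_pos⟩)
  refine ⟨fun m => if h : m < S.ncard then (e'.symm ⟨m, h⟩).1 else x₀, ?_, fun m => ?_,
    fun x hx => ?_⟩
  · simp [h_pos, e']
  · dsimp only
    split_ifs
    · exact Subtype.coe_prop _
    · exact hx₀
  · refine ⟨e' ⟨x, hx⟩, (e' ⟨x, hx⟩).2.trans_le hN, ?_⟩
    simp

theorem injective_mk_some {α β : Type*} (b : α) :
    Function.Injective fun c : β => (b, some c) :=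
  (Prod.mk_right_injective b).comp (Option.some_injective β)

section OptionCode

variable {A : Type u} [PartialOrder A] {G : Game A} {k n : ℕ}

/-- An encoding of the options of `G` by numbers, for which the numbers below `2 ^ k` suffice, and
payoff functions on `n` cells that realize the options. -/
structure OptionCode (G : Game A) (k n : ℕ) where
  /-- The option of a player with a given number. -/
  option : Bool → ℕ → Game A
  /-- The payoff function that realizes the option of a player with a given number. -/
  payoff : Bool → ℕ → (Fin n → Bool) →o A
  option_mem : ∀ s m, option s m ∈ opts s G
  exists_option : ∀ s, ∀ K ∈ opts s G, ∃ m < 2 ^ k, option s m = K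
  equivalent : ∀ s m, (option s m).Equivalent (cellGame (payoff s m)).value

theorem exists_optionCode (h_fin : ∀ s, (opts s G).Finite)
    (h_card : ∀ s, (opts s G).ncard ≤ 2 ^ k)
    (h_real : ∀ s, ∀ K ∈ opts s G, K.RealizableWithSize n) {K₀ : Bool → Game A}
    (hK₀ : ∀ s, K₀ s ∈ opts s G) : ∃ C : OptionCode G k n, ∀ s, C.option s 0 = K₀ s := by
  choose f hf₀ hf hf' using fun s => exists_enumeration (h_fin s) (hK₀ s) (h_card s)
  choose p hp using fun s m => (h_real s _ (hf s m)).exists_payoff le_rfl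
  exact ⟨⟨f, p, hf, hf', hp⟩, hf₀⟩

namespace OptionCode

variable (C : OptionCode G k n)

theorem sLe_positionValue {T : SetColoringGame A} {q : T.Position} {j : Fin n → T.carrier}
    (hj : Function.Injective j) {s t : Bool} {m : ℕ} (hq : ∀ c, q (j c) = none)
    (h_pay : ∀ w : T.carrier → Bool, (∀ d x, q d = some x → w d = x) →
      sideLe s (C.payoff t m (w ∘ j)) (T.payoff w)) :
    SLe s (C.option t m) (T.positionValue q) :=
  ((C.equivalent t m).sLe s).trans
    (SetColoringGame.Dominates.sLe hj ⟨fun c => .inl (hq c).symm, h_pay⟩)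

/-- The payoff functions for a game with good left and right options: a symbol determines one of
two copies of the cells and the option that is played there. -/
def copyPayoff (s : Bool) (x : Bool × ℕ) : (Bool × Fin n → Bool) →o A where
  toFun w := C.payoff s x.2 (w ∘ Prod.mk x.1)
  monotone' _ _ h := (C.payoff s x.2).monotone fun _ => h _

theorem sLe_copyPayoff {s t : Bool} {x : Bool × ℕ} {z : Bool × Fin n → Option Bool}
    (hz : ∀ c, z (x.1, c) = none) :
    SLe s (C.option t x.2) ((cellGame (C.copyPayoff t x)).positionValue z) :=
  C.sLe_positionValue (T := cellGame (C.copyPayoff t x)) (Prod.mk_right_injective x.1) hz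
    fun _ _ => sideLe_refl _ _

/-- An option on one of two copies of the cells, each of which has an additional cell that is
ignored. -/
def optionPayoff (t : Bool) (m : ℕ) (b : Bool) : (Bool × Option (Fin n) → Bool) →o A where
  toFun w := C.payoff t m fun c => w (b, some c)
  monotone' _ _ h := (C.payoff t m).monotone fun _ => h _

theorem sLe_optionPayoff {s t b : Bool} {m : ℕ} {z : Bool × Option (Fin n) → Option Bool}
    (hz : ∀ c, z (b, c) = none) :
    SLe s (C.option t m) ((cellGame (C.optionPayoff t m b)).positionValue z) :=
  C.sLe_positionValue (T := cellGame (C.optionPayoff t m b)) (injective_mk_some b)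
    (fun _ => hz _) fun _ _ => sideLe_refl _ _

variable [BoundedOrder A]

theorem realizableWithSize_of_good (h_good : ∀ s, SLe s G (C.option s 0)) (hG : ¬ G.IsAtomic) :
    G.RealizableWithSize (2 * n + (4 * k + 7)) := by
  have h := (hasSwitch_bool.addBits k).realizableWithSize C.copyPayoff hG (fun s K hK => ?_)
    (fun s j => ?_) (fun s x hx => ?_) fun s c => ?_
  · convert h using 1
    rw [Nat.card_prod, Nat.card_fin, Nat.card_eq_fintype_card, Fintype.card_bool]
    ring
  · obtain ⟨m, hm, rfl⟩ := C.exists_option s K hK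
    exact ⟨(false, m), ⟨trivial, hm⟩, C.sLe_copyPayoff (x := (false, m)) fun _ => rfl⟩
  · exact sTri_of_reply_left (C.option_mem (!s) _) (C.sLe_copyPayoff fun _ => rfl)
  · obtain ⟨b, m⟩ := x
    obtain ⟨-, rfl : m = 0⟩ := hx
    exact (h_good s).trans (C.sLe_copyPayoff (x := (b, 0)) fun _ => rfl)
  -- The opponent has played in one of the two copies; the other one is still intact.
  · obtain ⟨b, c⟩ := c
    refine ⟨(!b, 0), ⟨trivial, by positivity⟩,
      (h_good s).trans (C.sLe_copyPayoff (x := (!b, 0)) fun d => put_of_ne _ _ ?_)⟩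
    simp

/-- The game on one of two copies of the cells in which the color of an additional cell selects
between the good option of `g` and a win of the opponent. -/
def threatPayoff (g b : Bool) : (Bool × Option (Fin n) → Bool) →o A where
  toFun w :=
    if w (b, none) = g then C.payoff g 0 fun c => w (b, some c) else if g then ⊥ else ⊤
  monotone' v w h := by
    have h₁ := h (b, none)
    have h₂ := (C.payoff g 0).monotone (show (fun c => v (b, some c)) ≤ fun c => w (b, some c)
      from fun c => h _)
    dsimp only
    revert h₁
    cases g <;> cases v (b, none) <;> cases w (b, none) <;> simp [h₂]

variable {g b : Bool} {z : Bool × Option (Fin n) → Option Bool}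

theorem sLe_threatPayoff_put {s : Bool} (hz : ∀ c, z (b, c) = none) :
    SLe s (C.option g 0)
      ((cellGame (C.threatPayoff g b)).positionValue (put z (b, none) g)) := by
  refine C.sLe_positionValue (T := cellGame (C.threatPayoff g b)) (injective_mk_some b)
    (fun c => (put_of_ne _ _ (by simp)).trans (hz _)) fun w hw => ?_
  have h_color : w (b, none) = g := hw (b, none) g (put_self _ _ _)
  have h_pay : C.threatPayoff g b w = C.payoff g 0 fun c => w (b, some c) := if_pos h_color
  exact h_pay ▸ sideLe_refl s _

theorem sLe_threatPayoff_put_not (K : Game A) :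
    SLe (!g) K ((cellGame (C.threatPayoff g b)).positionValue (put z (b, none) !g)) := by
  refine sLe_positionValue_of_top (S := cellGame (C.threatPayoff g b)) (fun a w hw => ?_) K
  have h_color : w (b, none) = !g := hw (b, none) (!g) (put_self _ _ _)
  have h_pay : C.threatPayoff g b w = if !g then ⊤ else ⊥ :=
    (if_neg (by simp [h_color])).trans (by cases g <;> rfl)
  exact h_pay ▸ sideLe_top (!g) a

/-- The opponent of `g` threatens to win by a move in the additional cell, so `g` has to move
there. -/
theorem sLe_threatPayoff (hz : ∀ c, z (b, c) = none) :
    SLe (!g) G ((cellGame (C.threatPayoff g b)).positionValue z) := by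
  have h_threat {K : Game A} {z : Bool × Option (Fin n) → Option Bool} (h : z (b, none) = none) :
      STri (!g) K ((cellGame (C.threatPayoff g b)).positionValue z) :=
    (cellGame (C.threatPayoff g b)).sTri_of_move (c := (b, none)) h (C.sLe_threatPayoff_put_not K)
  refine (cellGame (C.threatPayoff g b)).sLe_positionValue (fun X _ => h_threat (hz _))
    (fun c hc => ?_) fun _ => h_threat (hz _)
  rw [Bool.not_not]
  obtain rfl | h := eq_or_ne c (b, none)
  · exact sTri_of_reply_left ((Bool.not_not g).symm ▸ C.option_mem g 0)
      (C.sLe_threatPayoff_put hz)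
  · exact h_threat ((put_of_ne z g h.symm).trans (hz _))

theorem sTri_threatPayoff (hg : SLe g G (C.option g 0)) :
    STri g G (cellGame (C.threatPayoff g b)).value :=
  (cellGame (C.threatPayoff g b)).sTri_of_move (c := (b, none)) rfl
    (hg.trans (C.sLe_threatPayoff_put fun _ => rfl))

/-- The payoff functions for a game in which the player `g` has a good option. A symbol determines
one of two copies of the cells, and what is played there: an option, or, for the symbols `1` and `2`
of the opponent of `g`, the game of `threatPayoff`. -/
def biasedPayoff (g s : Bool) (x : Fin 3 × ℕ) : (Bool × Option (Fin n) → Bool) →o A :=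
  if s = g ∨ x.1 = 0 then C.optionPayoff s x.2 (decide (x.1 = 1))
  else C.threatPayoff g (decide (x.1 = 1))

theorem sLe_option_biasedPayoff (s : Bool) (m : ℕ) :
    SLe s (C.option s m) (cellGame (C.biasedPayoff g s (0, m))).value := by
  rw [biasedPayoff, if_pos (.inr rfl)]
  exact C.sLe_optionPayoff fun _ => rfl

theorem sTri_biasedPayoff (hg : SLe g G (C.option g 0)) (s : Bool) (x : Fin 3 × ℕ) :
    STri s G (cellGame (C.biasedPayoff g (!s) x)).value := by
  by_cases hx : (!s) = g ∨ x.1 = 0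
  · rw [biasedPayoff, if_pos hx]
    exact sTri_of_reply_left (C.option_mem (!s) x.2) (C.sLe_optionPayoff fun _ => rfl)
  · rw [biasedPayoff, if_neg hx]
    obtain rfl : s = g := Bool.not_not_eq.1 (not_or.1 hx).1
    exact C.sTri_threatPayoff hg

theorem sLe_biasedPayoff (hg : SLe g G (C.option g 0)) {s : Bool} {i : Fin 3}
    (hi : i ∈ biasedGood g s) (hz : ∀ c, z (decide (i = 1), c) = none) :
    SLe s G ((cellGame (C.biasedPayoff g s (i, 0))).positionValue z) := by
  by_cases hs : s = g
  · rw [biasedPayoff, if_pos (.inl hs)]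
    subst hs
    exact hg.trans (C.sLe_optionPayoff hz)
  · have hi : i ≠ 0 := by simpa [biasedGood, hs] using hi
    rw [biasedPayoff, if_neg (not_or.2 ⟨hs, hi⟩)]
    obtain rfl : s = !g := Bool.eq_not.2 hs
    exact C.sLe_threatPayoff hz

theorem realizableWithSize_of_biased (hg : SLe g G (C.option g 0)) (hG : ¬ G.IsAtomic) :
    G.RealizableWithSize (2 * n + (4 * k + 10)) := by
  have h := ((hasSwitch_biased g).addBits k).realizableWithSize (C.biasedPayoff g) hG
    (fun s K hK => ?_) (C.sTri_biasedPayoff hg) (fun s x hx => ?_) fun s c => ?_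
  · convert h using 1
    rw [Nat.card_prod, Finite.card_option, Nat.card_fin, Nat.card_eq_fintype_card,
      Fintype.card_bool]
    ring
  · obtain ⟨m, hm, rfl⟩ := C.exists_option s K hK
    exact ⟨(0, m), ⟨by simp [biasedAvail], hm⟩, C.sLe_option_biasedPayoff s m⟩
  · obtain ⟨i, m⟩ := x
    obtain ⟨hi, rfl : m = 0⟩ := hx
    exact C.sLe_biasedPayoff hg hi fun _ => rfl
  · obtain ⟨i, ⟨hi, hi'⟩, hb⟩ := exists_mem_biasedAvail_inter_biasedGood g s !c.1
    refine ⟨(i, 0), ⟨hi, by positivity⟩, C.sLe_biasedPayoff hg hi' fun d => put_of_ne _ _ ?_⟩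
    rw [hb]
    exact fun h => Bool.not_ne_self c.1 (congrArg Prod.fst h)

end OptionCode

end OptionCode

section Step

variable {A : Type u} [PartialOrder A] [BoundedOrder A] {G : Game A} {k n : ℕ}

theorem Game.LocallyMonotone.realizableWithSize (h_mono : G.LocallyMonotone) (hG : ¬ G.IsAtomic)
    (h_fin : ∀ s, (opts s G).Finite) (h_card : ∀ s, (opts s G).ncard ≤ 2 ^ k)
    (h_real : ∀ s, ∀ K ∈ opts s G, K.RealizableWithSize n) :
    G.RealizableWithSize (2 * n + (4 * k + 7)) := by
  choose K₀ hK₀ using G.isAtomic_or_opts_nonempty.resolve_left hG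
  obtain ⟨C, hC⟩ := exists_optionCode h_fin h_card h_real hK₀
  refine C.realizableWithSize_of_good (fun s => ?_) hG
  rw [hC]
  cases s
  · exact h_mono.2 _ (hK₀ false)
  · exact h_mono.1 _ (hK₀ true)

theorem Game.LocallyPassable.realizableWithSize (h_pass : G.LocallyPassable) (hG : ¬ G.IsAtomic)
    (h_fin : ∀ s, (opts s G).Finite) (h_card : ∀ s, (opts s G).ncard ≤ 2 ^ k)
    (h_real : ∀ s, ∀ K ∈ opts s G, K.RealizableWithSize n) :
    G.RealizableWithSize (2 * n + (4 * k + 10)) := by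
  choose K₀ hK₀ using G.isAtomic_or_opts_nonempty.resolve_left hG
  obtain ⟨g, K, hK, hle⟩ : ∃ g, ∃ K ∈ opts g G, SLe g G K := by
    obtain ⟨K, hK, h⟩ | ⟨K, hK, h⟩ := h_pass.resolve_left hG
    · exact ⟨true, K, hK, h⟩
    · exact ⟨false, K, hK, h⟩
  have hK' : ∀ s, Function.update K₀ g K s ∈ opts s G :=
    (Function.forall_update_iff K₀ fun s X => X ∈ opts s G).2 ⟨hK, fun s _ => hK₀ s⟩
  obtain ⟨C, hC⟩ := exists_optionCode h_fin h_card h_real hK'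
  refine C.realizableWithSize_of_biased (g := g) ?_ hG
  rwa [hC, Function.update_self]

end Step

/-! ### Finite games -/

namespace Game

section Finite

variable {A : Type u} {G H K : Game A}

theorem positions_subset (h : H ∈ G.positions) : H.positions ⊆ G.positions :=
  fun _ hK => Relation.ReflTransGen.trans hK h

theorem IsOption.mem_positions (h : H.IsOption G) : H ∈ G.positions := .single h

theorem IsFinite.of_mem_positions (hG : G.IsFinite) (h : H ∈ G.positions) : H.IsFinite :=
  hG.subset (positions_subset h)

theorem IsFinite.finite_opts (hG : G.IsFinite) (s : Bool) : (opts s G).Finite :=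
  hG.subset fun _ h => (isOption_of_mem_opts h).mem_positions

theorem IsFinite.depth_lt (hG : G.IsFinite) (h : H.IsOption G) : H.depth < G.depth := by
  have : Finite {H : Game A // IsOption H G} :=
    (hG.subset fun K (hK : K.IsOption G) => hK.mem_positions).to_subtype
  rw [depth.eq_def G]
  exact le_ciSup (f := fun H : {H : Game A // IsOption H G} => depth H.1 + 1)
    (Set.finite_range _).bddAbove ⟨H, h⟩

theorem IsFinite.ncard_opts_le (hG : G.IsFinite) (h : H ∈ G.positions) (s : Bool) :
    (opts s H).ncard ≤ G.branchingFactor := by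
  refine le_csSup ?_ ⟨H, h, ?_⟩
  · refine (((hG.image fun H => H.leftOptions.ncard).union
      (hG.image fun H => H.rightOptions.ncard)).subset ?_).bddAbove
    rintro _ ⟨H, hH, rfl | rfl⟩
    · exact .inl ⟨H, hH, rfl⟩
    · exact .inr ⟨H, hH, rfl⟩
  · cases s
    · exact .inr rfl
    · exact .inl rfl

end Finite

variable {A : Type u} [PartialOrder A]

theorem IsFinite.realizableWithSize {G : Game A} (hG : G.IsFinite) {c : ℕ}
    (h_step : ∀ H ∈ G.positions, ¬ H.IsAtomic → ∀ n,
      (∀ s, ∀ K ∈ opts s H, K.RealizableWithSize n) → H.RealizableWithSize (2 * n + c)) :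
    G.RealizableWithSize ((2 ^ G.depth - 1) * c) := by
  induction G using option_induction with | _ G ih
  by_cases hA : G.IsAtomic
  · exact hA.realizableWithSize_zero.mono (Nat.zero_le _)
  obtain ⟨K, hK⟩ := (isAtomic_or_opts_nonempty G).resolve_left hA true
  obtain ⟨d, hd⟩ : ∃ d, G.depth = d + 1 :=
    Nat.exists_eq_add_one.2 (Nat.zero_lt_of_lt (hG.depth_lt (isOption_of_mem_opts hK)))
  have h_opts (s) (K) (hK : K ∈ opts s G) : K.RealizableWithSize ((2 ^ d - 1) * c) := by
    have hK' := isOption_of_mem_opts hK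
    have h_depth : K.depth ≤ d := by have := hG.depth_lt hK'; omega
    refine (ih s K hK (hG.of_mem_positions hK'.mem_positions) fun H hH =>
      h_step H (positions_subset hK'.mem_positions hH)).mono ?_
    gcongr
    exact one_le_two
  have h_size : (2 ^ G.depth - 1) * c = 2 * ((2 ^ d - 1) * c) + c := by
    obtain ⟨e, he⟩ := Nat.exists_eq_add_one.2 (Nat.two_pow_pos d)
    rw [hd, pow_succ, he, show (e + 1) * 2 - 1 = 2 * e + 1 by omega, Nat.add_sub_cancel]
    ring
  exact h_size ▸ h_step G .refl hA _ h_opts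

end Game

end PosetGame

theorem proposition4p5 {A : Type u} [PartialOrder A] [BoundedOrder A] (G : PosetGame.Game A)
    (hG : G.IsFinite) :
    (G.IsMonotone →
      G.RealizableWithSize ((2 ^ G.depth - 1) * (4 * Nat.clog 2 G.branchingFactor + 7))) ∧
    (G.IsPassable →
      G.RealizableWithSize ((2 ^ G.depth - 1) * (4 * Nat.clog 2 G.branchingFactor + 10))) := by
  have h_card (H) (hH : H ∈ G.positions) (s : Bool) :
      (PosetGame.Game.opts s H).ncard ≤ 2 ^ Nat.clog 2 G.branchingFactor :=
    (hG.ncard_opts_le hH s).trans (Nat.le_pow_clog Nat.one_lt_two _)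
  refine ⟨fun h => hG.realizableWithSize fun H hH hA n h_real => ?_,
    fun h => hG.realizableWithSize fun H hH hA n h_real => ?_⟩
  · exact (h H hH).realizableWithSize hA (hG.of_mem_positions hH).finite_opts (h_card H hH) h_real
  · exact (h H hH).realizableWithSize hA (hG.of_mem_positions hH).finite_opts (h_card H hH) h_real
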